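/- Let $N\ge 2$, $\omega=e^{2\pi i/N}$, and let $\mathfrak W=\{[a,b,c,d]\in\mathbb P^3(\mathbb C)\mid a^{2N}+c^{2N}=b^{2N}+d^{2N}\}$ be the Fermat surface. For a point $[k':k:k_0]$ of the conic $\Lambda=\{k^2+k'^2=k_0^2\}\subset\mathbb P^2(\mathbb C)$ (affine parameters $k'/k_0$, $k/k_0$, again written $k',k$; $k'=\infty$ means $k_0=0$) let $\mathfrak W_{k',k}\subset\mathfrak W$ be the curve $$k a^N+k'c^N=k_0d^N,\quad k b^N+k'd^N=k_0c^N,\quad k_0a^N+k'b^N=k d^N,\quad k'a^N+k_0b^N=k c^N .$$ The degenerate fibres are those over $k'=0,\pm1,\infty$; $\mathrm{Sing}(\mathfrak W_{k',k})$ denotes the set of singular points of such a curve. Let $H=\langle \mathsf V_0,\mathsf V_1\rangle$ be the group of automorphisms of $\mathfrak W$ generated by $\mathsf V_0:[a,b,c,d]\mapsto[\omega a,b,\omega c,d]$ and $\mathsf V_1:[a,b,c,d]\mapsto[\omega a,b,c,\omega d]$, and let $\mathfrak W/H$ be the quotient complex space (its holomorphic functions are the $H$-invariant holomorphic functions on $\mathfrak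 W$). Then $\mathfrak W/H$ carries the structure of a two-dimensional complex orbifold, compatible with its structure of a complex space, such that: (1) the set of points with nontrivial isotropy group, and likewise the set of singular points of the complex space $\mathfrak W/H$, is the set of images of the points of $\mathrm{Sing}(\mathfrak W_{k',k})$, $k'\in\{0,\infty,1,-1\}$; (2) if $\bar p\in\mathfrak W/H$ is the image of a point of $\mathrm{Sing}(\mathfrak W_{k',k})$ with $k'=0$ or $k'=\infty$, then near $\bar p$ the orbifold is $\mathbb C^2/\langle\mathrm{diag}(\omega,\omega)\rangle$ near the origin; in particular $(\mathfrak W/H,\bar p)\simeq(\mathbb C^2/\langle\mathrm{diag}(\omega,\omega)\rangle,0)$ as germs of complex spaces; (3) if $\bar p\in\mathfrak W/H$ is the image of a point of $\mathrm{Sing}(\mathfrak W_{k',k})$ with $k'=\pm1$, then near $\bar p$ the orbifold is $\mathbb C^2/\langle\mathrm{diag}(\omega,\omega^{-1})\rangle$ near the origin, i.e. a singularity of type $A_{N-1}$; in particular $(\mathfrak W/H,\bar p)\simeq(\mathbb C^2/\langle\mathrm{diag}(\omega,\omega^{-1})\rangle,0)$ as germs of complex spaces. -/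

import Mathlib

open scoped Topology LinearAlgebra.Projectivization

noncomputable section

namespace RapidityFamily

/-! ### Spaces with holomorphic functions, and isomorphism of germs -/

/-- A notion of "the complex valued function `f` is holomorphic near `x`" on a space `X`, i.e. a
(reduced) complex structure given by its sheaf of holomorphic functions. It is used only for the
concrete spaces below: `ℂⁿ`, projective sets, and orbit spaces. -/
class HolSpace (X : Type*) where
  holAt : (X → ℂ) → X → Prop

/-- `ℂⁿ` with its usual holomorphic functions. -/
instance affineHolSpace (n : ℕ) : HolSpace (Fin n → ℂ) where
  holAt f x := AnalyticAt ℂ f x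

/-- The complex topology of projective space: the quotient topology of `ℂⁿ ∖ {0}`. -/
instance projTopology (n : ℕ) : TopologicalSpace (ℙ ℂ (Fin n → ℂ)) :=
  inferInstanceAs (TopologicalSpace (Quotient (projectivizationSetoid ℂ (Fin n → ℂ))))

/-- A function on a subset `Z` of projective space is holomorphic at `p` if, in homogeneous
coordinates, it is near (every representative of) `p` the restriction to the cone over `Z` of a
holomorphic function of the ambient space. -/
instance projHolSpace {n : ℕ} (Z : Set (ℙ ℂ (Fin n → ℂ))) : HolSpace Z where
  holAt f p := ∀ (v : Fin n → ℂ) (hv : v ≠ 0), Projectivization.mk ℂ v hv = p.1 →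
    ∃ g : (Fin n → ℂ) → ℂ, AnalyticAt ℂ g v ∧
      ∀ᶠ w in 𝓝 v, ∀ (hw : w ≠ 0) (hZ : Projectivization.mk ℂ w hw ∈ Z),
        f ⟨Projectivization.mk ℂ w hw, hZ⟩ = g w

/-- The orbit space of a group action: its topology is the quotient topology (Mathlib's
instance), its holomorphic functions are the invariant holomorphic functions upstairs. -/
instance quotientHolSpace (G X : Type*) [Group G] [MulAction G X] [HolSpace X] :
    HolSpace (MulAction.orbitRel.Quotient G X) where
  holAt f q := ∀ x : X, (Quotient.mk _ x : MulAction.orbitRel.Quotient G X) = q →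
    HolSpace.holAt (fun y : X => f (Quotient.mk _ y)) x

/-- The germs `(X, x)` and `(Y, y)` are isomorphic: there is a homeomorphism of an open
neighbourhood of `x` onto one of `y` that takes `x` to `y` and identifies the holomorphic functions
on both sides. -/
def GermIso {X Y : Type*} [TopologicalSpace X] [TopologicalSpace Y] [HolSpace X] [HolSpace Y]
    (x : X) (y : Y) : Prop :=
  ∃ e : OpenPartialHomeomorph X Y, x ∈ e.source ∧ e x = y ∧
    ∀ x' ∈ e.source, ∀ f : Y → ℂ,
      HolSpace.holAt f (e x') ↔ HolSpace.holAt (fun z : X => f (e z)) x'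

/-- `x` is a nonsingular point of the `n`-dimensional complex space `X`. -/
def IsNonsingularAt {X : Type*} [TopologicalSpace X] [HolSpace X] (n : ℕ) (x : X) : Prop :=
  GermIso x (0 : Fin n → ℂ)

/-! ### Complex orbifolds -/

/-- The general linear group of `ℂⁿ`; it acts on `ℂⁿ` and on the projective space of `ℂⁿ`. -/
abbrev GLin (n : ℕ) : Type := (Fin n → ℂ) ≃ₗ[ℂ] (Fin n → ℂ)

/-- The diagonal matrix with diagonal entries `t`. -/
def diag {n : ℕ} (t : Fin n → ℂˣ) : GLin n :=
  LinearEquiv.piCongrRight fun i => LinearEquiv.smulOfUnit (t i)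

/-- An orbifold chart of `X`: a connected open set of `ℂⁿ`, a finite group acting on it (taken
linear, hence effective), and a map that induces an isomorphism of complex spaces from the orbit
space of the domain onto an open set of `X`. The values of `toFun` off the domain are irrelevant. -/
structure OrbifoldChart (n : ℕ) (X : Type*) [TopologicalSpace X] [HolSpace X] where
  dom : Set (Fin n → ℂ)
  isOpen_dom : IsOpen dom
  isConnected_dom : IsConnected dom
  group : Subgroup (GLin n)
  finite_group : Finite group
  map_dom : ∀ g ∈ group, ∀ x ∈ dom, g x ∈ dom
  toFun : (Fin n → ℂ) → X
  continuousOn_toFun : ContinuousOn toFun dom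
  isOpen_image : ∀ V ⊆ dom, IsOpen V → IsOpen (toFun '' V)
  toFun_eq_iff : ∀ x ∈ dom, ∀ y ∈ dom, toFun x = toFun y ↔ ∃ g ∈ group, g x = y
  holAt_iff : ∀ x ∈ dom, ∀ f : X → ℂ,
    HolSpace.holAt f (toFun x) ↔ HolSpace.holAt (fun z => f (toFun z)) x

/-- A complex orbifold structure on `X`: orbifold charts that cover `X`, any two of which are
related, near points with the same image, by a local biholomorphic map over `X`. -/
structure OrbifoldAtlas (n : ℕ) (X : Type*) [TopologicalSpace X] [HolSpace X] where
  t2Space : T2Space X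
  secondCountable : SecondCountableTopology X
  charts : Set (OrbifoldChart n X)
  cover : ∀ q : X, ∃ c ∈ charts, q ∈ c.toFun '' c.dom
  compatible : ∀ c ∈ charts, ∀ c' ∈ charts, ∀ x ∈ c.dom, ∀ y ∈ c'.dom, c.toFun x = c'.toFun y →
    ∃ h : OpenPartialHomeomorph (Fin n → ℂ) (Fin n → ℂ),
      x ∈ h.source ∧ h x = y ∧ h.source ⊆ c.dom ∧ h.target ⊆ c'.dom ∧
      AnalyticOnNhd ℂ h h.source ∧ AnalyticOnNhd ℂ h.symm h.target ∧
      ∀ z ∈ h.source, c'.toFun (h z) = c.toFun z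

/-- The singular locus of an orbifold: the points with nontrivial isotropy group. -/
def OrbifoldAtlas.singularLocus {n : ℕ} {X : Type*} [TopologicalSpace X] [HolSpace X]
    (A : OrbifoldAtlas n X) : Set X :=
  {q | ∃ c ∈ A.charts, ∃ x ∈ c.dom, c.toFun x = q ∧ ∃ g ∈ c.group, g ≠ 1 ∧ g x = x}

/-- Near `q` the orbifold is `ℂⁿ / G` near the origin: it has a chart with group `G` centred
at `q`. -/
def OrbifoldAtlas.LocallyQuotient {n : ℕ} {X : Type*} [TopologicalSpace X] [HolSpace X]
    (A : OrbifoldAtlas n X) (q : X) (G : Subgroup (GLin n)) : Prop :=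
  ∃ c ∈ A.charts, c.group = G ∧ (0 : Fin n → ℂ) ∈ c.dom ∧ c.toFun 0 = q

/-! ### Projective sets and their singular points -/

/-- The common zeros in projective space of a family of homogeneous polynomials. -/
def projZeros {m n : ℕ} (F : Fin m → MvPolynomial (Fin n) ℂ) : Set (ℙ ℂ (Fin n → ℂ)) :=
  {p | ∀ i, MvPolynomial.eval p.rep (F i) = 0}

/-- The Jacobian matrix of a family of polynomials at a vector. -/
def jacobian {m n : ℕ} (F : Fin m → MvPolynomial (Fin n) ℂ) (v : Fin n → ℂ) :
    Matrix (Fin m) (Fin n) ℂ :=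
  Matrix.of fun i j => MvPolynomial.eval v (MvPolynomial.pderiv j (F i))

/-- The singular points (Jacobian criterion) of a projective variety of codimension `c` given by
the homogeneous equations `F`. -/
def projSing {m n : ℕ} (c : ℕ) (F : Fin m → MvPolynomial (Fin n) ℂ) : Set (ℙ ℂ (Fin n → ℂ)) :=
  {p | p ∈ projZeros F ∧ (jacobian F p.rep).rank < c}

/-! ### The rapidity family

The homogeneous coordinates `a, b, c, d` have the indices `0, 1, 2, 3`. -/

open MvPolynomial in
/-- The equation `a^{2N} + c^{2N} = b^{2N} + d^{2N}`. -/
def fermatEq (N : ℕ) : Fin 1 → MvPolynomial (Fin 4) ℂ :=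
  ![X 0 ^ (2 * N) + X 2 ^ (2 * N) - (X 1 ^ (2 * N) + X 3 ^ (2 * N))]

/-- The rapidity family, as the Fermat surface in projective 3-space. -/
abbrev Fermat (N : ℕ) : Type := projZeros (fermatEq N)

/-- Homogeneous coordinates `[k' : k : k₀]` of a point of the conic `k² + k'² = k₀²`. The affine
parameters are `k'/k₀` and `k/k₀`; the points at infinity are those with `k₀ = 0`. -/
structure Param where
  k' : ℂ
  k : ℂ
  k₀ : ℂ
  ne_zero : (k', k, k₀) ≠ 0
  conic : k ^ 2 + k' ^ 2 = k₀ ^ 2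

/-- `k' = 0` or `k' = ∞`. -/
def Param.ZeroOrInfty (κ : Param) : Prop := κ.k' = 0 ∨ κ.k₀ = 0

/-- `k' = 1` or `k' = -1`. -/
def Param.PlusMinusOne (κ : Param) : Prop := κ.k' = κ.k₀ ∨ κ.k' = -κ.k₀

open MvPolynomial in
/-- The four equations of the rapidity curve over a parameter, homogenized in the parameter:
`k a^N + k' c^N = k₀ d^N`, `k b^N + k' d^N = k₀ c^N`,
`k₀ a^N + k' b^N = k d^N`, `k' a^N + k₀ b^N = k c^N`. -/
def rapidityEqs (N : ℕ) (κ : Param) : Fin 4 → MvPolynomial (Fin 4) ℂ :=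
  ![C κ.k * X 0 ^ N + C κ.k' * X 2 ^ N - C κ.k₀ * X 3 ^ N,
    C κ.k * X 1 ^ N + C κ.k' * X 3 ^ N - C κ.k₀ * X 2 ^ N,
    C κ.k₀ * X 0 ^ N + C κ.k' * X 1 ^ N - C κ.k * X 3 ^ N,
    C κ.k' * X 0 ^ N + C κ.k₀ * X 1 ^ N - C κ.k * X 2 ^ N]

/-- The singular points of the fibre over `κ`, a curve in projective 3-space. -/
def fibreSing (N : ℕ) (κ : Param) : Set (Fermat N) :=
  {p | p.1 ∈ projSing 2 (rapidityEqs N κ)}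

/-- `ω = exp (2πi/N)`. -/
def omega (N : ℕ) : ℂˣ := Units.mk0 (Complex.exp (2 * Real.pi * Complex.I / N)) (Complex.exp_ne_zero _)

lemma omega_pow (N : ℕ) : (omega N : ℂ) ^ (2 * N) = 1 := by
  rcases eq_or_ne N 0 with rfl | h
  · simp
  · have := (Complex.isPrimitiveRoot_exp N h).pow_eq_one
    rw [mul_comm, pow_mul]
    simp [omega, this]

lemma diag_smul_mem (N : ℕ) (t : Fin 4 → ℂˣ) (ht : ∀ i, (t i : ℂ) ^ (2 * N) = 1)
    (p : ℙ ℂ (Fin 4 → ℂ)) : diag t • p ∈ projZeros (fermatEq N) ↔ p ∈ projZeros (fermatEq N) := by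
  obtain ⟨s, hs⟩ := Projectivization.exists_smul_eq_mk_rep ℂ (diag t • p.rep)
    ((smul_ne_zero_iff_ne _).2 p.rep_nonzero)
  have hq : diag t • p = Projectivization.mk ℂ (diag t • p.rep)
      ((smul_ne_zero_iff_ne _).2 p.rep_nonzero) := by
    conv_lhs => rw [← p.mk_rep]
    rfl
  have hr : ∀ i, (diag t • p).rep i = s * (t i * p.rep i) := by
    intro i
    rw [hq, ← hs]
    rfl
  have hs0 : (s : ℂ) ^ (2 * N) ≠ 0 := pow_ne_zero _ s.ne_zero
  simp only [projZeros, fermatEq, Set.mem_ofPred_eq, Fin.forall_fin_one, Matrix.cons_val_fin_one,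
    map_sub, map_add, map_pow, MvPolynomial.eval_X, hr, mul_pow, ht, one_mul]
  rw [← mul_add, ← mul_add, ← mul_sub, mul_eq_zero]
  simp [hs0]

/-- The automorphism of the Fermat surface that multiplies the four coordinates by `t`. -/
def diagAut (N : ℕ) (t : Fin 4 → ℂˣ) (ht : ∀ i, (t i : ℂ) ^ (2 * N) = 1) :
    Equiv.Perm (Fermat N) :=
  (MulAction.toPerm (diag t) : Equiv.Perm (ℙ ℂ (Fin 4 → ℂ))).subtypePerm (diag_smul_mem N t ht)

/-- `V₀ : [a, b, c, d] ↦ [ω a, b, ω c, d]`. -/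
def V₀ (N : ℕ) : Equiv.Perm (Fermat N) :=
  diagAut N ![omega N, 1, omega N, 1] (by intro i; fin_cases i <;> simp [omega_pow])

/-- `V₁ : [a, b, c, d] ↦ [ω a, b, c, ω d]`. -/
def V₁ (N : ℕ) : Equiv.Perm (Fermat N) :=
  diagAut N ![omega N, 1, 1, omega N] (by intro i; fin_cases i <;> simp [omega_pow])

/-- The group `H` of automorphisms of the Fermat surface generated by `V₀` and `V₁`. -/
def H (N : ℕ) : Subgroup (Equiv.Perm (Fermat N)) := Subgroup.closure {V₀ N, V₁ N}

/-- The quotient surface. -/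
abbrev WH (N : ℕ) : Type := MulAction.orbitRel.Quotient (H N) (Fermat N)

/-- The image in the quotient surface of a point of the Fermat surface. -/
def toWH (N : ℕ) (p : Fermat N) : WH N := Quotient.mk _ p

/-- The images of the singular points of the degenerate fibres, those over `k' = 0, ∞, ±1`. -/
def singImage (N : ℕ) : Set (WH N) :=
  {q | ∃ κ : Param, (κ.ZeroOrInfty ∨ κ.PlusMinusOne) ∧ ∃ p ∈ fibreSing N κ, toWH N p = q}

/-- The orbit space `ℂ² / G`. -/
abbrev PlaneQuotient (G : Subgroup (GLin 2)) : Type := MulAction.orbitRel.Quotient G (Fin 2 → ℂ)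

/-- The image of the origin in `ℂ² / G`. -/
def planeOrigin (G : Subgroup (GLin 2)) : PlaneQuotient G := Quotient.mk _ 0

/-- The group generated by `diag(ω, ω)`. -/
def scalarGroup (N : ℕ) : Subgroup (GLin 2) := Subgroup.zpowers (diag ![omega N, omega N])

/-- The group generated by `diag(ω, ω⁻¹)`, which defines the singularity of type `A_{N-1}`. -/
def typeAGroup (N : ℕ) : Subgroup (GLin 2) := Subgroup.zpowers (diag ![omega N, (omega N)⁻¹])

end RapidityFamily

end

/-!
Modulo scalars, `H` is the group of diagonal matrices whose entries are `N`-th roots of unity with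
`t₀ * t₁ = t₂ * t₃`. Such a matrix other than a scalar fixes a point of the Fermat surface only if
two of its homogeneous coordinates vanish, and by the Jacobian criterion these are the singular
points of the degenerate fibres. The two vanishing coordinates, divided by a third one, are local
coordinates at such a point. In them the stabilizer acts linearly, as the cyclic group generated by
`diag(ω, ω)` or `diag(ω, ω⁻¹)`, depending on the pair of vanishing coordinates.

The quotient of the plane by such a group is singular at the origin. Otherwise all invariant
functions are functions of two invariants `φ` vanishing at `0`, so a nontrivial combination of the
three invariant monomials `x ^ N`, `x ^ a * y ^ b` and `y ^ N`, with `x ^ a * y ^ b` equal to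
`x ^ (N - 1) * y` or `x * y`, is `o(φ)`. But `φ` vanishes to order `N` along the axes and to order
`a + b` along the diagonal, and this forces the three coefficients to be `0`.
-/

open scoped Topology LinearAlgebra.Projectivization

noncomputable section

namespace RapidityFamily

section Germs

theorem GermIso.trans {X Y Z : Type*} [TopologicalSpace X] [TopologicalSpace Y]
    [TopologicalSpace Z] [HolSpace X] [HolSpace Y] [HolSpace Z] {x : X} {y : Y} {z : Z}
    (hxy : GermIso x y) (hyz : GermIso y z) : GermIso x z := by
  obtain ⟨e, hx, rfl, he⟩ := hxy
  obtain ⟨e', hy, rfl, he'⟩ := hyz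
  refine ⟨e.trans e', by simp [hx, hy], rfl, fun x' hx' f => ?_⟩
  rw [OpenPartialHomeomorph.trans_source] at hx'
  exact (he' _ hx'.2 f).trans (he _ hx'.1 fun y => f (e' y))

/-- On the open set `D` of `ℂⁿ` the map `α` is an open map, and the holomorphic functions on its
image are the functions that become holomorphic on `D`: the complex space `α '' D` is the quotient
of `D` by the fibres of `α`. -/
structure IsHolQuotientOn {n : ℕ} {X : Type*} [TopologicalSpace X] [HolSpace X]
    (α : (Fin n → ℂ) → X) (D : Set (Fin n → ℂ)) : Prop where
  isOpen : IsOpen D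
  continuousOn : ContinuousOn α D
  isOpen_image : ∀ V ⊆ D, IsOpen V → IsOpen (α '' V)
  holAt_iff : ∀ x ∈ D, ∀ f : X → ℂ,
    HolSpace.holAt f (α x) ↔ AnalyticAt ℂ (fun z => f (α z)) x

theorem apply_invFunOn_apply_of_fibres {E X Y : Type*} [Nonempty E] {D : Set E}
    {α : E → X} {β : E → Y}
    (fibres : ∀ x ∈ D, ∀ y ∈ D, α x = α y ↔ β x = β y) {x : E} (hx : x ∈ D) :
    β (Function.invFunOn α D (α x)) = β x := by
  have hex : ∃ y ∈ D, α y = α x := ⟨x, hx, rfl⟩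
  exact (fibres _ (Function.invFunOn_mem hex) _ hx).1 (Function.invFunOn_eq hex)

variable {n : ℕ} {X Y : Type*} [TopologicalSpace X] [TopologicalSpace Y]
  {D : Set (Fin n → ℂ)} {α : (Fin n → ℂ) → X} {β : (Fin n → ℂ) → Y}

theorem IsHolQuotientOn.continuousOn_comp_invFunOn [HolSpace X] (hα : IsHolQuotientOn α D)
    (hβ : ContinuousOn β D) (fibres : ∀ x ∈ D, ∀ y ∈ D, α x = α y ↔ β x = β y) :
    ContinuousOn (fun q => β (Function.invFunOn α D q)) (α '' D) := by
  rw [continuousOn_open_iff (hα.isOpen_image D subset_rfl hα.isOpen)]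
  intro V hV
  have preimage_eq :
      α '' D ∩ (fun q => β (Function.invFunOn α D q)) ⁻¹' V = α '' (D ∩ β ⁻¹' V) := by
    ext q
    constructor
    · rintro ⟨⟨x, hx, rfl⟩, hq⟩
      exact ⟨x, ⟨hx, by simpa [apply_invFunOn_apply_of_fibres fibres hx] using hq⟩, rfl⟩
    · rintro ⟨x, ⟨hx, hq⟩, rfl⟩
      exact ⟨⟨x, hx, rfl⟩, by simpa [apply_invFunOn_apply_of_fibres fibres hx] using hq⟩
  rw [preimage_eq]
  exact hα.isOpen_image _ Set.inter_subset_left (hβ.isOpen_inter_preimage hα.isOpen hV)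

theorem IsHolQuotientOn.germIso [HolSpace X] [HolSpace Y] (hα : IsHolQuotientOn α D)
    (hβ : IsHolQuotientOn β D) (fibres : ∀ x ∈ D, ∀ y ∈ D, α x = α y ↔ β x = β y)
    {x : Fin n → ℂ} (hx : x ∈ D) : GermIso (α x) (β x) := by
  have fibres_symm : ∀ x ∈ D, ∀ y ∈ D, β x = β y ↔ α x = α y :=
    fun x hx y hy => (fibres x hx y hy).symm
  have hαβ {y} (hy : y ∈ D) := apply_invFunOn_apply_of_fibres fibres hy
  have hβα {y} (hy : y ∈ D) := apply_invFunOn_apply_of_fibres fibres_symm hy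
  refine ⟨{ toFun := fun q => β (Function.invFunOn α D q)
            invFun := fun q => α (Function.invFunOn β D q)
            source := α '' D
            target := β '' D
            map_source' := ?_
            map_target' := ?_
            left_inv' := ?_
            right_inv' := ?_
            open_source := hα.isOpen_image D subset_rfl hα.isOpen
            open_target := hβ.isOpen_image D subset_rfl hβ.isOpen
            continuousOn_toFun := hα.continuousOn_comp_invFunOn hβ.continuousOn fibres
            continuousOn_invFun := hβ.continuousOn_comp_invFunOn hα.continuousOn fibres_symm },
    ⟨x, hx, rfl⟩, hαβ hx, ?_⟩
  · rintro _ ⟨y, hy, rfl⟩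
    exact ⟨y, hy, (hαβ hy).symm⟩
  · rintro _ ⟨y, hy, rfl⟩
    exact ⟨y, hy, (hβα hy).symm⟩
  · rintro _ ⟨y, hy, rfl⟩
    simp only [hαβ hy, hβα hy]
  · rintro _ ⟨y, hy, rfl⟩
    simp only [hαβ hy, hβα hy]
  · rintro _ ⟨y, hy, rfl⟩ f
    change HolSpace.holAt f (β (Function.invFunOn α D (α y))) ↔
      HolSpace.holAt (fun z => f (β (Function.invFunOn α D z))) (α y)
    rw [hαβ hy, hβ.holAt_iff y hy, hα.holAt_iff y hy]
    refine analyticAt_congr ?_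
    filter_upwards [hα.isOpen.mem_nhds hy] with z hz
    rw [hαβ hz]

theorem isHolQuotientOn_sub_const (hD : IsOpen D) (a : Fin n → ℂ) :
    IsHolQuotientOn (fun z => z - a) D where
  isOpen := hD
  continuousOn := by fun_prop
  isOpen_image V _ hV := (Homeomorph.subRight a).isOpenMap V hV
  holAt_iff x _ f := by
    refine ⟨fun h => h.fun_comp (g := f) (f := fun z => z - a) (by fun_prop), fun h => ?_⟩
    have h' : AnalyticAt ℂ (fun z => f (z - a)) ((x - a) + a) := by rwa [sub_add_cancel]
    have h'' := h'.fun_comp (f := fun z => z + a) (by fun_prop)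
    simp only [add_sub_cancel_right] at h''
    exact h''

end Germs

section OrbitSpaces

/-- The group `G` acts on `X` by automorphisms of its complex structure. -/
def ActsHolomorphically (G X : Type*) [Group G] [MulAction G X] [HolSpace X] : Prop :=
  ∀ (g : G) (x : X) (f : X → ℂ), HolSpace.holAt f (g • x) ↔ HolSpace.holAt (fun y => f (g • y)) x

theorem ActsHolomorphically.of_holAt_smul {G X : Type*} [Group G] [MulAction G X] [HolSpace X]
    (h : ∀ (g : G) (x : X) (f : X → ℂ),
      HolSpace.holAt f (g • x) → HolSpace.holAt (fun y => f (g • y)) x) :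
    ActsHolomorphically G X := fun g x f =>
  ⟨h g x f, fun hf => by
    simpa only [smul_inv_smul] using
      h g⁻¹ (g • x) (fun y => f (g • y)) (by rwa [inv_smul_smul])⟩

theorem ActsHolomorphically.holAt_mk_iff {G X : Type*} [Group G] [MulAction G X] [HolSpace X]
    (hG : ActsHolomorphically G X) (f : MulAction.orbitRel.Quotient G X → ℂ) (x : X) :
    HolSpace.holAt f (Quotient.mk _ x : MulAction.orbitRel.Quotient G X) ↔
      HolSpace.holAt (fun y : X => f (Quotient.mk _ y)) x := by
  refine ⟨fun h => h x rfl, fun h y hy => ?_⟩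
  obtain ⟨g, rfl⟩ : ∃ g : G, g • x = y := MulAction.orbitRel_apply.1 (Quotient.exact hy)
  rw [hG]
  convert h using 3
  exact Quotient.sound (MulAction.orbitRel_apply.2 ⟨g, rfl⟩)

theorem orbitRel_mk_eq_mk_iff {G X : Type*} [Group G] [MulAction G X] {x y : X} :
    (Quotient.mk _ x : MulAction.orbitRel.Quotient G X) = Quotient.mk _ y ↔
      ∃ g : G, g • x = y := by
  rw [Quotient.eq, MulAction.orbitRel_apply, ← MulAction.mem_orbit_symm]
  rfl

variable {n : ℕ}

theorem analyticAt_coord (i : Fin n) (x : Fin n → ℂ) :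
    AnalyticAt ℂ (fun z : Fin n → ℂ => z i) x :=
  (ContinuousLinearMap.proj (R := ℂ) (φ := fun _ : Fin n => ℂ) i).analyticAt x

theorem analyticAt_linear (g : GLin n) (x : Fin n → ℂ) :
    AnalyticAt ℂ (fun y : Fin n → ℂ => g y) x :=
  (LinearMap.toContinuousLinearMap (g : (Fin n → ℂ) →ₗ[ℂ] (Fin n → ℂ))).analyticAt x

theorem actsHolomorphically_linear (K : Subgroup (GLin n)) :
    ActsHolomorphically K (Fin n → ℂ) :=
  .of_holAt_smul fun g x f (hf : AnalyticAt ℂ f (g • x)) =>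
    hf.fun_comp (f := fun y => g • y) (analyticAt_linear (g : GLin n) x)

instance linearContinuousConstSMul (K : Subgroup (GLin n)) :
    ContinuousConstSMul K (Fin n → ℂ) where
  continuous_const_smul g := continuous_iff_continuousAt.2 fun x =>
    (analyticAt_linear (g : GLin n) x).continuousAt

theorem linear_mk_eq_mk_iff {K : Subgroup (GLin n)} {x y : Fin n → ℂ} :
    (Quotient.mk _ x : MulAction.orbitRel.Quotient K (Fin n → ℂ)) = Quotient.mk _ y ↔
      ∃ g ∈ K, g x = y := by
  rw [orbitRel_mk_eq_mk_iff]
  exact ⟨fun ⟨g, hg⟩ => ⟨g, g.2, hg⟩, fun ⟨g, hg, h⟩ => ⟨⟨g, hg⟩, h⟩⟩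

theorem isHolQuotientOn_linear_mk (K : Subgroup (GLin n)) {D : Set (Fin n → ℂ)} (hD : IsOpen D) :
    IsHolQuotientOn
      (fun x => (Quotient.mk _ x : MulAction.orbitRel.Quotient K (Fin n → ℂ))) D where
  isOpen := hD
  continuousOn := continuous_quotient_mk'.continuousOn
  isOpen_image V _ hV := isOpenMap_quotient_mk'_mul V hV
  holAt_iff x _ f := (actsHolomorphically_linear K).holAt_mk_iff f x

variable {X : Type*} [TopologicalSpace X] [HolSpace X] (c : OrbifoldChart n X)

theorem OrbifoldChart.isHolQuotientOn : IsHolQuotientOn c.toFun c.dom :=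
  ⟨c.isOpen_dom, c.continuousOn_toFun, c.isOpen_image, c.holAt_iff⟩

theorem OrbifoldChart.germIso {x : Fin n → ℂ} (hx : x ∈ c.dom) :
    GermIso (c.toFun x) (Quotient.mk _ x : MulAction.orbitRel.Quotient c.group (Fin n → ℂ)) :=
  c.isHolQuotientOn.germIso (isHolQuotientOn_linear_mk c.group c.isOpen_dom)
    (fun x hx y hy => (c.toFun_eq_iff x hx y hy).trans linear_mk_eq_mk_iff.symm) hx

theorem OrbifoldChart.germIso_symm {x : Fin n → ℂ} (hx : x ∈ c.dom) :
    GermIso (Quotient.mk _ x : MulAction.orbitRel.Quotient c.group (Fin n → ℂ)) (c.toFun x) :=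
  (isHolQuotientOn_linear_mk c.group c.isOpen_dom).germIso c.isHolQuotientOn
    (fun x hx y hy => linear_mk_eq_mk_iff.trans (c.toFun_eq_iff x hx y hy).symm) hx

theorem OrbifoldChart.isNonsingularAt_of_group_eq_bot (hc : c.group = ⊥) {x : Fin n → ℂ}
    (hx : x ∈ c.dom) : IsNonsingularAt n (c.toFun x) := by
  have h := c.isHolQuotientOn.germIso (isHolQuotientOn_sub_const c.isOpen_dom x)
    (fun y hy z hz => by simp [c.toFun_eq_iff y hy z hz, hc]) hx
  simpa only [IsNonsingularAt, sub_self] using h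

end OrbitSpaces

/-! ### Quotients of complex manifolds by finite groups -/

section LocalParametrizations

variable {n : ℕ} {X : Type*} [TopologicalSpace X]

/-- A local biholomorphic parametrization of `X` by an open set of `ℂⁿ`. -/
def IsLocalParam [HolSpace X] (e : OpenPartialHomeomorph (Fin n → ℂ) X) : Prop :=
  ∀ x ∈ e.source, ∀ f : X → ℂ, HolSpace.holAt f (e x) ↔ AnalyticAt ℂ (fun z => f (e z)) x

theorem IsLocalParam.restrOpen [HolSpace X] {e : OpenPartialHomeomorph (Fin n → ℂ) X}
    (he : IsLocalParam e) {D : Set (Fin n → ℂ)} (hD : IsOpen D) :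
    IsLocalParam (e.restrOpen D hD) := fun x hx => he x hx.1

theorem locallyCompactSpace_of_localParams
    (h : ∀ p : X, ∃ e : OpenPartialHomeomorph (Fin n → ℂ) X, p ∈ e.target) :
    LocallyCompactSpace X := by
  choose e he using h
  let _ : ChartedSpace (Fin n → ℂ) X :=
    { atlas := Set.range fun p => (e p).symm
      chartAt := fun p => (e p).symm
      mem_chart_source := he
      chart_mem_atlas := Set.mem_range_self }
  exact ChartedSpace.locallyCompactSpace (Fin n → ℂ) X

theorem IsLocalParam.holAt_symm_apply [HolSpace X] {e : OpenPartialHomeomorph (Fin n → ℂ) X}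
    (he : IsLocalParam e) {p : X} (hp : p ∈ e.target) (i : Fin n) :
    HolSpace.holAt (fun q => e.symm q i) p := by
  have analytic : AnalyticAt ℂ (fun z => e.symm (e z) i) (e.symm p) := by
    refine (analyticAt_coord i _).congr ?_
    filter_upwards [e.open_source.mem_nhds (e.map_target hp)] with z hz
    rw [e.left_inv hz]
  simpa only [e.right_inv hp] using
    (he (e.symm p) (e.map_target hp) fun q => e.symm q i).2 analytic

variable {G : Type*} [Group G] [MulAction G X]

theorem IsLocalParam.analyticAt_symm_smul [HolSpace X] (hG : ActsHolomorphically G X)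
    {e e' : OpenPartialHomeomorph (Fin n → ℂ) X} (he : IsLocalParam e) (he' : IsLocalParam e')
    {g : G} {z : Fin n → ℂ} (hz : z ∈ e.source) (hgz : g • e z ∈ e'.target) :
    AnalyticAt ℂ (fun w => e'.symm (g • e w)) z :=
  analyticAt_pi_iff.2 fun i => (he z hz _).1 ((hG g _ _).1 (he'.holAt_symm_apply hgz i))

theorem IsLocalParam.exists_transition [HolSpace X] [ContinuousConstSMul G X]
    (hG : ActsHolomorphically G X) {e e' : OpenPartialHomeomorph (Fin n → ℂ) X}
    (he : IsLocalParam e) (he' : IsLocalParam e') {x y : Fin n → ℂ} (hx : x ∈ e.source)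
    (hy : y ∈ e'.source) {g : G} (hg : g • e x = e' y) :
    ∃ h : OpenPartialHomeomorph (Fin n → ℂ) (Fin n → ℂ),
      x ∈ h.source ∧ h x = y ∧ h.source ⊆ e.source ∧ h.target ⊆ e'.source ∧
      AnalyticOnNhd ℂ h h.source ∧ AnalyticOnNhd ℂ h.symm h.target ∧
      ∀ z ∈ h.source, e' (h z) = g • e z := by
  let h := (e.trans (Homeomorph.smul g).toOpenPartialHomeomorph).trans e'.symm
  have mem_source {z} : z ∈ h.source ↔ z ∈ e.source ∧ g • e z ∈ e'.target := by simp [h]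
  have mem_target {z} : z ∈ h.target ↔ z ∈ e'.source ∧ g⁻¹ • e' z ∈ e.target := by simp [h]
  refine ⟨h, mem_source.2 ⟨hx, hg ▸ e'.map_source hy⟩, ?_, fun z hz => (mem_source.1 hz).1,
    fun z hz => (mem_target.1 hz).1, fun z hz => ?_, fun z hz => ?_, fun z hz => ?_⟩
  · change e'.symm (g • e x) = y
    rw [hg, e'.left_inv hy]
  · exact he.analyticAt_symm_smul hG he' (mem_source.1 hz).1 (mem_source.1 hz).2
  · exact he'.analyticAt_symm_smul hG he (mem_target.1 hz).1 (mem_target.1 hz).2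
  · exact e'.right_inv (mem_source.1 hz).2

/-- In the parametrization `e` the transformation `g` of `X` becomes the linear map `k`. -/
def Linearizes (e : OpenPartialHomeomorph (Fin n → ℂ) X) (g : G) (k : GLin n) : Prop :=
  ∀ x ∈ e.source, k x ∈ e.source ∧ e (k x) = g • e x

theorem Linearizes.apply_eq_self {e : OpenPartialHomeomorph (Fin n → ℂ) X} {g : G} {k : GLin n}
    (h : Linearizes e g k) {x : Fin n → ℂ} (hx : x ∈ e.source) (hg : g • e x = e x) : k x = x :=
  e.injOn (h x hx).1 hx ((h x hx).2.trans hg)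

end LocalParametrizations

section FiniteQuotients

variable {n : ℕ} {G X : Type*} [TopologicalSpace X] [HolSpace X] [Group G] [MulAction G X]

/-- An orbifold chart of an orbit space is lifted if it is a local parametrization upstairs
followed by the projection, and its group linearizes transformations in `G`. -/
def IsLiftedChart (c : OrbifoldChart n (MulAction.orbitRel.Quotient G X)) : Prop :=
  ∃ e : OpenPartialHomeomorph (Fin n → ℂ) X, IsLocalParam e ∧ e.source = c.dom ∧
    (∀ x ∈ c.dom, c.toFun x = Quotient.mk _ (e x)) ∧ ∀ k ∈ c.group, ∃ g : G, Linearizes e g k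

theorem GLin.eq_one_of_eqOn {k : GLin n} {D : Set (Fin n → ℂ)} (hD : IsOpen D)
    (hne : D.Nonempty) (hk : ∀ x ∈ D, k x = x) : k = 1 := by
  have eqLocus_eq_top : LinearMap.eqLocus (k : (Fin n → ℂ) →ₗ[ℂ] (Fin n → ℂ)) LinearMap.id = ⊤ :=
    Submodule.eq_top_of_nonempty_interior' _ (hne.mono (interior_maximal hk hD))
  exact LinearEquiv.ext fun x => (eqLocus_eq_top ▸ Submodule.mem_top :
    x ∈ LinearMap.eqLocus (k : (Fin n → ℂ) →ₗ[ℂ] (Fin n → ℂ)) LinearMap.id)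

theorem IsLiftedChart.exists_smul_eq_of_apply_eq
    {c : OrbifoldChart n (MulAction.orbitRel.Quotient G X)} (hc : IsLiftedChart c) {k : GLin n}
    (hk : k ∈ c.group) (hk1 : k ≠ 1) {x : Fin n → ℂ} (hx : x ∈ c.dom) (hkx : k x = x) :
    ∃ (g : G) (p : X), c.toFun x = Quotient.mk _ p ∧ g • p = p ∧ ∃ q : X, g • q ≠ q := by
  obtain ⟨e, -, he, hmk, hlin⟩ := hc
  obtain ⟨g, hg⟩ := hlin k hk
  rw [← he] at hx
  refine ⟨g, e x, hmk x (he ▸ hx), by rw [← (hg x hx).2, hkx], ?_⟩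
  by_contra! htriv
  exact hk1 (GLin.eq_one_of_eqOn e.open_source ⟨x, hx⟩ fun z hz => hg.apply_eq_self hz (htriv _))

variable [ContinuousConstSMul G X]

/-- The orbifold chart of an orbit space induced by a local parametrization upstairs. -/
def liftedChart (hG : ActsHolomorphically G X) (e : OpenPartialHomeomorph (Fin n → ℂ) X)
    (he : IsLocalParam e) (hconn : IsConnected e.source) (K : Subgroup (GLin n)) (hK : Finite K)
    (hlin : ∀ k ∈ K, ∃ g : G, Linearizes e g k)
    (hfib : ∀ x ∈ e.source, ∀ y ∈ e.source, (∃ g : G, g • e x = e y) → ∃ k ∈ K, k x = y) :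
    OrbifoldChart n (MulAction.orbitRel.Quotient G X) where
  dom := e.source
  isOpen_dom := e.open_source
  isConnected_dom := hconn
  group := K
  finite_group := hK
  map_dom k hk x hx := ((hlin k hk).choose_spec x hx).1
  toFun x := Quotient.mk _ (e x)
  continuousOn_toFun := continuous_quotient_mk'.comp_continuousOn e.continuousOn
  isOpen_image V hV hVo := by
    rw [← Set.image_image (fun y => (Quotient.mk _ y : MulAction.orbitRel.Quotient G X)) e V]
    exact isOpenMap_quotient_mk'_mul _ (e.isOpen_image_of_subset_source hVo hV)
  toFun_eq_iff x hx y hy := by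
    rw [orbitRel_mk_eq_mk_iff]
    refine ⟨hfib x hx y hy, ?_⟩
    rintro ⟨k, hk, rfl⟩
    exact (hlin k hk).imp fun g hg => (hg x hx).2.symm
  holAt_iff x hx f := (hG.holAt_mk_iff f (e x)).trans (he x hx _)

theorem exists_liftedChart [Finite G] [T2Space X] [LocallyCompactSpace X]
    (hG : ActsHolomorphically G X) {e : OpenPartialHomeomorph (Fin n → ℂ) X} (he : IsLocalParam e)
    {a : Fin n → ℂ} (ha : a ∈ e.source) {K : Subgroup (GLin n)} (hK : Finite K)
    (hnorm : ∀ k ∈ K, ∀ x, ‖k x‖ = ‖x‖)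
    (hstab : ∀ g : G, g • e a = e a → ∃ k ∈ K, Linearizes e g k)
    (hlin : ∀ k ∈ K, ∃ g : G, g • e a = e a ∧ Linearizes e g k) :
    ∃ c : OrbifoldChart n (MulAction.orbitRel.Quotient G X), IsLiftedChart c ∧ c.group = K ∧
      a ∈ c.dom ∧ c.toFun a = Quotient.mk _ (e a) := by
  obtain ⟨U, hU, hUstab⟩ := ProperlyDiscontinuousSMul.exists_nhds_image_smul_eq_self G (e a)
  obtain ⟨r, hr, hball⟩ := Metric.mem_nhds_iff.1 (Filter.inter_mem (e.open_source.mem_nhds ha)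
    ((e.continuousAt ha).preimage_mem_nhds hU))
  let e₀ := e.restrOpen (Metric.ball a r) Metric.isOpen_ball
  have source_eq : e₀.source = Metric.ball a r :=
    Set.inter_eq_right.2 (hball.trans Set.inter_subset_left)
  have map_ball : ∀ k ∈ K, ∀ x ∈ Metric.ball a r, k x ∈ Metric.ball a r := by
    intro k hk x hx
    obtain ⟨g, hga, hg⟩ := hlin k hk
    rw [mem_ball_iff_norm] at hx ⊢
    rwa [← hg.apply_eq_self ha hga, ← map_sub, hnorm k hk]
  have hlin₀ : ∀ k ∈ K, ∃ g : G, Linearizes e₀ g k := by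
    intro k hk
    obtain ⟨g, -, hg⟩ := hlin k hk
    exact ⟨g, fun x hx => ⟨⟨(hg x hx.1).1, map_ball k hk x hx.2⟩, (hg x hx.1).2⟩⟩
  have hfib : ∀ x ∈ e₀.source, ∀ y ∈ e₀.source, (∃ g : G, g • e₀ x = e₀ y) → ∃ k ∈ K, k x = y := by
    rintro x ⟨hx, hxr⟩ y ⟨hy, hyr⟩ ⟨g, hgxy⟩
    have hga : g • e a = e a := hUstab g ⟨e y, ⟨e x, (hball hxr).2, hgxy⟩, (hball hyr).2⟩
    obtain ⟨k, hk, hgk⟩ := hstab g hga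
    exact ⟨k, hk, e.injOn (hgk x hx).1 hy ((hgk x hx).2.trans hgxy)⟩
  have hconn : IsConnected e₀.source := by
    rw [source_eq]
    exact Metric.isConnected_ball hr
  exact ⟨liftedChart hG e₀ (he.restrOpen _) hconn K hK hlin₀ hfib,
    ⟨e₀, he.restrOpen _, rfl, fun _ _ => rfl, hlin₀⟩, rfl, ⟨ha, Metric.mem_ball_self hr⟩, rfl⟩

/-- The orbifold structure of the orbit space of a finite group of automorphisms: its charts are
the lifted ones. -/
def quotientAtlas [Finite G] [T2Space X] [LocallyCompactSpace X] [SecondCountableTopology X]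
    (hG : ActsHolomorphically G X)
    (hcover : ∀ q, ∃ c : OrbifoldChart n (MulAction.orbitRel.Quotient G X),
      IsLiftedChart c ∧ q ∈ c.toFun '' c.dom) :
    OrbifoldAtlas n (MulAction.orbitRel.Quotient G X) where
  t2Space := inferInstanceAs (T2Space (Quotient (MulAction.orbitRel G X)))
  secondCountable := ContinuousConstSMul.secondCountableTopology
  charts := {c | IsLiftedChart c}
  cover := hcover
  compatible := by
    rintro c ⟨e, he, hce, hmk, -⟩ c' ⟨e', he', hce', hmk', -⟩ x hx y hy hxy
    rw [hmk x hx, hmk' y hy, orbitRel_mk_eq_mk_iff] at hxy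
    obtain ⟨g, hg⟩ := hxy
    rw [← hce] at hx
    rw [← hce'] at hy
    obtain ⟨h, hxh, hhx, hsrc, htgt, hana, hana', hover⟩ := he.exists_transition hG he' hx hy hg
    rw [hce] at hsrc
    rw [hce'] at htgt
    refine ⟨h, hxh, hhx, hsrc, htgt, hana, hana', fun z hz => ?_⟩
    rw [hmk z (hsrc hz), hmk' _ (htgt (h.map_source hz)), hover z hz]
    exact (orbitRel_mk_eq_mk_iff.2 ⟨g, rfl⟩).symm

end FiniteQuotients

/-! ### Singular quotients by cyclic groups -/

section Order

open Asymptotics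

theorem isBigO_pow_of_iteratedDeriv_eq_zero {f : ℂ → ℂ} (hf : AnalyticAt ℂ f 0) {n : ℕ}
    (h : ∀ k < n, iteratedDeriv k f 0 = 0) : f =O[𝓝 0] fun t : ℂ => t ^ n := by
  obtain ⟨g, hg, hfg⟩ := (natCast_le_analyticOrderAt hf).1
    ((natCast_le_analyticOrderAt_iff_iteratedDeriv_eq_zero hf).2 h)
  refine (((isBigO_refl (fun t : ℂ => t ^ n) _).mul
    (hg.continuousAt.tendsto.isBigO_one ℂ)).congr' ?_ (.of_forall fun t => mul_one _))
  filter_upwards [hfg] with t ht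
  rw [ht, sub_zero, smul_eq_mul]

theorem iteratedDeriv_fun_mul_left (f : ℂ → ℂ) (ζ : ℂ) (k : ℕ) :
    iteratedDeriv k (fun t => f (ζ * t)) = fun t => ζ ^ k * iteratedDeriv k f (ζ * t) := by
  induction k with
  | zero => simp
  | succ k ih =>
    ext t
    rw [iteratedDeriv_succ, ih, deriv_const_mul_field, deriv_comp_mul_left, smul_eq_mul,
      iteratedDeriv_succ, pow_succ, mul_assoc]

theorem isBigO_pow_of_invariant {N : ℕ} {ζ : ℂ} (hζ : IsPrimitiveRoot ζ N) {f : ℂ → ℂ}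
    (hf : AnalyticAt ℂ f 0) (hf0 : f 0 = 0) (hinv : ∀ t, f (ζ * t) = f t) :
    f =O[𝓝 0] fun t : ℂ => t ^ N := by
  refine isBigO_pow_of_iteratedDeriv_eq_zero hf fun k hk => ?_
  rcases Nat.eq_zero_or_pos k with rfl | hk0
  · rwa [iteratedDeriv_zero]
  · have eigen : ζ ^ k * iteratedDeriv k f 0 = iteratedDeriv k f 0 := by
      have h := congrFun (iteratedDeriv_fun_mul_left f ζ k) 0
      simp only [hinv, mul_zero] at h
      exact h.symm
    exact (mul_left_eq_self₀.1 eigen).resolve_left (hζ.pow_ne_one_of_pos_of_lt hk0.ne' hk)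

theorem eq_zero_of_const_mul_pow_isLittleO {c : ℂ} {n : ℕ}
    (h : (fun t : ℂ => c * t ^ n) =o[𝓝 0] fun t : ℂ => t ^ n) : c = 0 := by
  by_contra hc
  have hself : (fun t : ℂ => t ^ n) =o[𝓝[≠] 0] fun t : ℂ => t ^ n :=
    ((isLittleO_const_mul_left_iff hc).1 h).mono nhdsWithin_le_nhds
  refine isLittleO_irrefl (Filter.Eventually.frequently ?_) hself
  filter_upwards [self_mem_nhdsWithin] with t ht using pow_ne_zero n ht

theorem exists_sum_mul_isLittleO {ι E : Type*} [Fintype ι] [NormedAddCommGroup E]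
    [NormedSpace ℂ E] [FiniteDimensional ℂ E] (hι : Module.finrank ℂ E < Fintype.card ι)
    {h : ι → E → ℂ} (hh : ∀ i, DifferentiableAt ℂ (h i) 0) (h0 : ∀ i, h i 0 = 0) :
    ∃ c : ι → ℂ, c ≠ 0 ∧ (fun z => ∑ i, c i * h i z) =o[𝓝 0] fun z : E => z := by
  let L : (ι → ℂ) →ₗ[ℂ] Module.Dual ℂ E :=
    Fintype.linearCombination ℂ fun i => (fderiv ℂ (h i) 0 : E →ₗ[ℂ] ℂ)
  obtain ⟨c, hc, hc0⟩ : ∃ c ∈ LinearMap.ker L, c ≠ 0 :=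
    (Submodule.ne_bot_iff _).1 (LinearMap.ker_ne_bot_of_finrank_lt
      (by rwa [Subspace.dual_finrank_eq, Module.finrank_fintype_fun_eq_card]))
  have deriv_eq_zero : HasFDerivAt (fun z => ∑ i, c i * h i z) (0 : E →L[ℂ] ℂ) 0 := by
    have hsum : HasFDerivAt (fun z => ∑ i, c i * h i z) (∑ i, c i • fderiv ℂ (h i) 0) 0 :=
      HasFDerivAt.fun_sum fun i _ => (hh i).hasFDerivAt.const_mul (c i)
    convert hsum
    ext z
    simpa [L, Fintype.linearCombination_apply] using (LinearMap.congr_fun hc z).symm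
  refine ⟨c, hc0, ?_⟩
  simpa [h0] using deriv_eq_zero.isLittleO

end Order

section InvariantFunctions

open Asymptotics

variable {n : ℕ} {K : Subgroup (GLin n)}

theorem tendsto_smul_nhds_zero (w : Fin n → ℂ) :
    Filter.Tendsto (fun t : ℂ => t • w) (𝓝 0) (𝓝 0) := by
  simpa only [zero_smul] using
    (show ContinuousAt (fun t : ℂ => t • w) 0 by fun_prop).tendsto

theorem analyticAt_restrict_line {f : (Fin n → ℂ) → ℂ} (hf : AnalyticAt ℂ f 0) (w : Fin n → ℂ) :
    AnalyticAt ℂ (fun t : ℂ => f (t • w)) 0 :=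
  AnalyticAt.fun_comp (g := f) (f := fun t : ℂ => t • w) (by rwa [zero_smul]) (by fun_prop)

theorem isBigO_pow_line_of_invariant {N : ℕ} {ζ : ℂ} (hζ : IsPrimitiveRoot ζ N)
    {f : (Fin n → ℂ) → ℂ} (hf : AnalyticAt ℂ f 0) (hf0 : f 0 = 0) {g : GLin n}
    (hinv : ∀ z, f (g z) = f z) {w : Fin n → ℂ} (hw : g w = ζ • w) :
    (fun t : ℂ => f (t • w)) =O[𝓝 0] fun t : ℂ => t ^ N :=
  isBigO_pow_of_invariant hζ (analyticAt_restrict_line hf w) (by rwa [zero_smul]) fun t => by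
    rw [← hinv (t • w), map_smul, hw, smul_smul, mul_comm]

theorem fderiv_apply_sub_eq_zero_of_invariant {f : (Fin n → ℂ) → ℂ} {g : GLin n}
    (hinv : ∀ z, f (g z) = f z) (w : Fin n → ℂ) : fderiv ℂ f 0 (g w - w) = 0 := by
  have h := g.toContinuousLinearEquiv.comp_right_fderiv (f := f) (x := 0)
  rw [show f ∘ g.toContinuousLinearEquiv = f from funext hinv, map_zero] at h
  rw [map_sub, sub_eq_zero]
  exact (DFunLike.congr_fun h w).symm

theorem isBigO_sq_line_of_fderiv_eq_zero {f : (Fin n → ℂ) → ℂ} (hf : AnalyticAt ℂ f 0)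
    (hf0 : f 0 = 0) {w : Fin n → ℂ} (hw : fderiv ℂ f 0 w = 0) :
    (fun t : ℂ => f (t • w)) =O[𝓝 0] fun t : ℂ => t ^ 2 := by
  refine isBigO_pow_of_iteratedDeriv_eq_zero (analyticAt_restrict_line hf w) fun k hk => ?_
  interval_cases k
  · rwa [iteratedDeriv_zero, zero_smul]
  · have hderiv : HasDerivAt (fun t : ℂ => f (t • w)) (fderiv ℂ f 0 w) 0 :=
      hf.differentiableAt.hasFDerivAt.comp_hasDerivAt_of_eq (0 : ℂ)
        (by simpa using (hasDerivAt_id (0 : ℂ)).smul_const w) (zero_smul ℂ w).symm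
    rw [iteratedDeriv_one, hderiv.deriv, hw]

theorem exists_generators_of_isNonsingularAt
    (hK : IsNonsingularAt n (Quotient.mk _ 0 : MulAction.orbitRel.Quotient K (Fin n → ℂ))) :
    ∃ φ : (Fin n → ℂ) → (Fin n → ℂ), AnalyticAt ℂ φ 0 ∧ φ 0 = 0 ∧
      (∀ g ∈ K, ∀ z, φ (g z) = φ z) ∧
      ∀ F : (Fin n → ℂ) → ℂ, AnalyticAt ℂ F 0 → (∀ g ∈ K, ∀ z, F (g z) = F z) →
        ∃ h : (Fin n → ℂ) → ℂ, AnalyticAt ℂ h 0 ∧ ∀ᶠ z in 𝓝 0, F z = h (φ z) := by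
  obtain ⟨e, h0, he0, he⟩ := hK
  have holAt_iff := (actsHolomorphically_linear K).holAt_mk_iff
  refine ⟨fun z => e (Quotient.mk _ z), ?_, he0, fun g hg z => ?_, fun F hF hinv => ?_⟩
  · exact analyticAt_pi_iff.2 fun i =>
      (holAt_iff (fun q => e q i) 0).1 ((he _ h0 fun z => z i).1 (analyticAt_coord i _))
  · exact congrArg e (linear_mk_eq_mk_iff.2 ⟨g, hg, rfl⟩).symm
  · let f : MulAction.orbitRel.Quotient K (Fin n → ℂ) → ℂ := Quotient.lift F (by
      intro a b hab
      obtain ⟨g, hg, rfl⟩ := linear_mk_eq_mk_iff.1 (Quotient.sound hab)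
      exact (hinv g hg a).symm)
    have F_eq : ∀ᶠ z in 𝓝 (0 : Fin n → ℂ), F z = f (e.symm (e (Quotient.mk _ z))) := by
      filter_upwards [(continuous_quotient_mk'.continuousAt (x := (0 : Fin n → ℂ))).eventually
        (e.open_source.mem_nhds h0)] with z hz
      change Quotient.mk _ z ∈ e.source at hz
      rw [e.left_inv hz]
      rfl
    have analytic := (he _ h0 fun z => f (e.symm z)).2
      ((holAt_iff (fun q => f (e.symm (e q))) 0).2 (hF.congr F_eq))
    exact ⟨fun z => f (e.symm z), he0 ▸ analytic, F_eq⟩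

theorem exists_relation_of_isNonsingularAt
    (hK : IsNonsingularAt n (Quotient.mk _ 0 : MulAction.orbitRel.Quotient K (Fin n → ℂ)))
    {ι : Type*} [Fintype ι] (hι : n < Fintype.card ι) {F : ι → (Fin n → ℂ) → ℂ}
    (hF : ∀ i, AnalyticAt ℂ (F i) 0) (hF0 : ∀ i, F i 0 = 0)
    (hinv : ∀ i, ∀ g ∈ K, ∀ z, F i (g z) = F i z) :
    ∃ φ : (Fin n → ℂ) → (Fin n → ℂ), AnalyticAt ℂ φ 0 ∧ φ 0 = 0 ∧
      (∀ g ∈ K, ∀ z, φ (g z) = φ z) ∧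
      ∃ c : ι → ℂ, c ≠ 0 ∧ (fun z => ∑ i, c i * F i z) =o[𝓝 0] φ := by
  obtain ⟨φ, hφ, hφ0, hφK, hgen⟩ := exists_generators_of_isNonsingularAt hK
  choose h hh hFh using fun i => hgen (F i) (hF i) (hinv i)
  have hh0 : ∀ i, h i 0 = 0 := fun i => by
    rw [← hφ0, ← (hFh i).self_of_nhds, hF0]
  obtain ⟨c, hc0, hc⟩ := exists_sum_mul_isLittleO (by rwa [Module.finrank_fin_fun])
    (fun i => (hh i).differentiableAt) hh0
  have hφt : Filter.Tendsto φ (𝓝 0) (𝓝 0) := by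
    simpa only [hφ0] using hφ.continuousAt.tendsto
  refine ⟨φ, hφ, hφ0, hφK, c, hc0, (hc.comp_tendsto hφt).congr' ?_ .rfl⟩
  filter_upwards [Filter.eventually_all.2 hFh] with z hz
  simp only [hz, Function.comp_apply]

end InvariantFunctions

section CyclicPlaneQuotients

open Asymptotics

@[simp]
theorem diag_apply {n : ℕ} (t : Fin n → ℂˣ) (x : Fin n → ℂ) (i : Fin n) :
    diag t x i = t i * x i := rfl

theorem diag_pair_apply (u v : ℂˣ) (x y : ℂ) : diag ![u, v] ![x, y] = ![u * x, v * y] := by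
  ext i
  fin_cases i <;> rfl

theorem invariant_of_mem_zpowers {G X Y : Type*} [Group G] [MulAction G X] {F : X → Y} {g : G}
    (hg : ∀ x, F (g • x) = F x) {k : G} (hk : k ∈ Subgroup.zpowers g) (x : X) :
    F (k • x) = F x := by
  let S : Subgroup G :=
    { carrier := {k | ∀ x, F (k • x) = F x}
      mul_mem' := fun ha hb x => by rw [mul_smul, ha, hb]
      one_mem' := fun x => by rw [one_smul]
      inv_mem' := fun {a} ha x => by rw [← ha (a⁻¹ • x), smul_inv_smul] }
  exact Subgroup.zpowers_le.2 (show g ∈ S from hg) hk x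

/-- The monomials `x ^ N`, `x ^ a * y ^ b` and `y ^ N` in the coordinates of the plane. -/
def threeMonomials (N a b : ℕ) : Fin 3 → (Fin 2 → ℂ) → ℂ :=
  ![fun z => z 0 ^ N, fun z => z 0 ^ a * z 1 ^ b, fun z => z 1 ^ N]

variable {N a b : ℕ} {u v : ℂˣ}

theorem analyticAt_threeMonomials (i : Fin 3) (z : Fin 2 → ℂ) :
    AnalyticAt ℂ (threeMonomials N a b i) z := by
  have h0 := analyticAt_coord 0 z
  have h1 := analyticAt_coord 1 z
  fin_cases i
  exacts [h0.pow _, (h0.pow _).mul (h1.pow _), h1.pow _]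

theorem threeMonomials_diag_apply (hu : (u : ℂ) ^ N = 1) (hv : (v : ℂ) ^ N = 1)
    (huv : (u : ℂ) ^ a * (v : ℂ) ^ b = 1) (i : Fin 3) (z : Fin 2 → ℂ) :
    threeMonomials N a b i (diag ![u, v] z) = threeMonomials N a b i z := by
  fin_cases i
  · simp [threeMonomials, mul_pow, hu]
  · simp only [threeMonomials, Fin.mk_one, Matrix.cons_val, diag_apply]
    linear_combination (z 0 ^ a * z 1 ^ b) * huv
  · simp [threeMonomials, mul_pow, hv]

/-- The relation between the three monomials that holds at a nonsingular point is trivial: on each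
axis only one monomial survives, and on the diagonal the middle one dominates the other two. -/
theorem not_isNonsingularAt_zpowers_diag (hN : N ≠ 0) (ha : a ≠ 0) (hb : b ≠ 0)
    (hu : IsPrimitiveRoot (u : ℂ) N) (hv : IsPrimitiveRoot (v : ℂ) N)
    (huv : (u : ℂ) ^ a * (v : ℂ) ^ b = 1)
    (hdiagonal : ∀ f : (Fin 2 → ℂ) → ℂ, AnalyticAt ℂ f 0 → f 0 = 0 →
      (∀ z, f (diag ![u, v] z) = f z) →
      (fun t : ℂ => f (t • ![1, 1])) =O[𝓝 0] fun t : ℂ => t ^ (a + b)) :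
    ¬ IsNonsingularAt 2 (planeOrigin (Subgroup.zpowers (diag ![u, v]))) := by
  intro hK
  obtain ⟨φ, hφ, hφ0, hφK, c, hc, hrel⟩ := exists_relation_of_isNonsingularAt hK (by simp)
    (fun i => analyticAt_threeMonomials (N := N) (a := a) (b := b) i 0)
    (fun i => by fin_cases i <;> simp [threeMonomials, hN, ha])
    (fun i _ hg z => invariant_of_mem_zpowers
      (threeMonomials_diag_apply hu.pow_eq_one hv.pow_eq_one huv i) hg z)
  have coord_invariant (i : Fin 2) (z : Fin 2 → ℂ) : φ (diag ![u, v] z) i = φ z i :=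
    congrFun (hφK _ (Subgroup.mem_zpowers _) z) i
  have coord_isBigO {ζ : ℂ} {w : Fin 2 → ℂ} (hζ : IsPrimitiveRoot ζ N)
      (hw : diag ![u, v] w = ζ • w) : (fun t : ℂ => φ (t • w)) =O[𝓝 0] fun t : ℂ => t ^ N :=
    isBigO_pi.2 fun i => isBigO_pow_line_of_invariant hζ (analyticAt_pi_iff.1 hφ i)
      (congrFun hφ0 i) (coord_invariant i) hw
  have diagonal_isBigO :
      (fun t : ℂ => φ (t • ![1, 1])) =O[𝓝 0] fun t : ℂ => t ^ (a + b) :=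
    isBigO_pi.2 fun i => hdiagonal _ (analyticAt_pi_iff.1 hφ i) (congrFun hφ0 i)
      (coord_invariant i)
  have line_isLittleO (x y : ℂ) : (fun t : ℂ => c 0 * (t * x) ^ N +
      c 1 * ((t * x) ^ a * (t * y) ^ b) + c 2 * (t * y) ^ N) =o[𝓝 0] fun t => φ (t • ![x, y]) :=
    (hrel.comp_tendsto (tendsto_smul_nhds_zero ![x, y])).congr_left fun t => by
      simp [Fin.sum_univ_three, threeMonomials]
  have hc0 : c 0 = 0 := eq_zero_of_const_mul_pow_isLittleO
    (((line_isLittleO 1 0).trans_isBigO (coord_isBigO hu (by simp [diag_pair_apply]))).congr_left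
      fun t => by simp [hN, hb])
  have hc2 : c 2 = 0 := eq_zero_of_const_mul_pow_isLittleO
    (((line_isLittleO 0 1).trans_isBigO (coord_isBigO hv (by simp [diag_pair_apply]))).congr_left
      fun t => by simp [hN, ha])
  have hc1 : c 1 = 0 := eq_zero_of_const_mul_pow_isLittleO
    (((line_isLittleO 1 1).trans_isBigO diagonal_isBigO).congr_left
      fun t => by simp [hc0, hc2, pow_add])
  exact hc (by ext i; fin_cases i <;> simp [hc0, hc1, hc2])

theorem isPrimitiveRoot_omega (hN : N ≠ 0) : IsPrimitiveRoot (omega N : ℂ) N :=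
  Complex.isPrimitiveRoot_exp N hN

theorem not_isNonsingularAt_scalarGroup (hN : 2 ≤ N) :
    ¬ IsNonsingularAt 2 (planeOrigin (scalarGroup N)) := by
  have hω := isPrimitiveRoot_omega (N := N) (by lia)
  have hpred : N - 1 + 1 = N := by lia
  refine not_isNonsingularAt_zpowers_diag (a := N - 1) (b := 1) (by lia) (by lia) one_ne_zero
    hω hω (by rw [← pow_add, hpred, hω.pow_eq_one]) fun f hf hf0 hinv => ?_
  rw [hpred]
  exact isBigO_pow_line_of_invariant hω hf hf0 hinv (by simp [diag_pair_apply])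

theorem not_isNonsingularAt_typeAGroup (hN : 2 ≤ N) :
    ¬ IsNonsingularAt 2 (planeOrigin (typeAGroup N)) := by
  have hω := isPrimitiveRoot_omega (N := N) (by lia)
  have hω_inv : IsPrimitiveRoot (((omega N)⁻¹ : ℂˣ) : ℂ) N := by
    simpa only [Units.val_inv_eq_inv_val] using hω.inv
  refine not_isNonsingularAt_zpowers_diag (a := 1) (b := 1) (by lia) one_ne_zero one_ne_zero
    hω hω_inv (by simp) fun f hf hf0 hinv => isBigO_sq_line_of_fderiv_eq_zero hf hf0 ?_
  have h := fderiv_apply_sub_eq_zero_of_invariant hinv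
    ![((omega N : ℂ) - 1)⁻¹, (((omega N)⁻¹ : ℂˣ) - 1 : ℂ)⁻¹]
  have sub_eq (ζ : ℂ) (hζ : ζ ≠ 1) : ζ * (ζ - 1)⁻¹ - (ζ - 1)⁻¹ = 1 := by
    rw [← sub_one_mul, mul_inv_cancel₀ (sub_ne_zero.2 hζ)]
  rwa [diag_pair_apply, Matrix.cons_sub_cons, Matrix.cons_sub_cons,
    sub_eq _ (hω.ne_one (by lia)), sub_eq _ (hω_inv.ne_one (by lia)), Matrix.empty_sub_empty] at h

end CyclicPlaneQuotients

/-! ### Projective space -/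

section Projective

variable {n : ℕ}

theorem mk_eq_mk_iff_minors {K ι : Type*} [Field K] {v w : ι → K} (hv : v ≠ 0) (hw : w ≠ 0) :
    Projectivization.mk K v hv = Projectivization.mk K w hw ↔ ∀ i j, v i * w j = v j * w i := by
  rw [Projectivization.mk_eq_mk_iff']
  constructor
  · rintro ⟨a, rfl⟩ i j
    simp only [Pi.smul_apply, smul_eq_mul, mul_assoc, mul_comm (w i)]
  · intro h
    obtain ⟨j, hj : w j ≠ 0⟩ := Function.ne_iff.1 hw
    refine ⟨v j / w j, funext fun i => ?_⟩
    rw [Pi.smul_apply, smul_eq_mul, div_mul_eq_mul_div, div_eq_iff hj, h]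

/-- The ratio of the homogeneous coordinates `r` and `l`, equal to `0` where `l` vanishes. -/
def coordRatio {K ι : Type*} [Field K] (r l : ι) (p : ℙ K (ι → K)) : K := p.rep r / p.rep l

@[simp]
theorem coordRatio_mk {K ι : Type*} [Field K] (r l : ι) {v : ι → K} (hv : v ≠ 0) :
    coordRatio r l (Projectivization.mk K v hv) = v r / v l := by
  obtain ⟨a, ha⟩ := Projectivization.exists_smul_eq_mk_rep K v hv
  rw [coordRatio, ← ha]
  simp [Units.smul_def, mul_div_mul_left]

theorem mk_rep_apply_eq_zero_iff {K ι : Type*} [Field K] (l : ι) {v : ι → K} (hv : v ≠ 0) :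
    (Projectivization.mk K v hv).rep l = 0 ↔ v l = 0 := by
  obtain ⟨a, ha⟩ := Projectivization.exists_smul_eq_mk_rep K v hv
  rw [← ha]
  simp [Units.smul_def]

theorem continuous_coord (i : Fin n) : Continuous fun v : {v : Fin n → ℂ // v ≠ 0} => v.1 i :=
  (continuous_apply i).comp continuous_subtype_val

theorem continuous_projMk :
    Continuous (Projectivization.mk' ℂ : {v : Fin n → ℂ // v ≠ 0} → ℙ ℂ (Fin n → ℂ)) :=
  continuous_quotient_mk' (s := projectivizationSetoid ℂ (Fin n → ℂ))

theorem isOpenQuotientMap_projMk :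
    IsOpenQuotientMap (Projectivization.mk' ℂ : {v : Fin n → ℂ // v ≠ 0} → ℙ ℂ (Fin n → ℂ)) := by
  refine ⟨fun p => ⟨⟨p.rep, p.rep_nonzero⟩, p.mk_rep⟩, continuous_projMk, fun U hU => ?_⟩
  refine (isQuotientMap_quotient_mk' (s := projectivizationSetoid ℂ (Fin n → ℂ))).isOpen_preimage.1
    ?_
  let scale (a : ℂˣ) (v : {v : Fin n → ℂ // v ≠ 0}) : {v : Fin n → ℂ // v ≠ 0} :=
    ⟨a • v.1, (smul_ne_zero_iff_ne a).2 v.2⟩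
  have continuous_scale : ∀ a, Continuous (scale a) := fun a =>
    (continuous_subtype_val.const_smul (a : ℂ)).subtype_mk _
  have saturation : Quotient.mk (projectivizationSetoid ℂ (Fin n → ℂ)) ⁻¹'
      (Projectivization.mk' ℂ '' U) = ⋃ a, scale a ⁻¹' U := by
    ext v
    simp only [Set.mem_preimage, Set.mem_iUnion]
    constructor
    · rintro ⟨w, hw, hwv⟩
      obtain ⟨a, ha⟩ := (Projectivization.mk_eq_mk_iff ℂ w.1 v.1 w.2 v.2).1 hwv
      exact ⟨a, (show scale a v = w from Subtype.ext ha) ▸ hw⟩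
    · rintro ⟨a, ha⟩
      exact ⟨scale a v, ha, (Projectivization.mk_eq_mk_iff ℂ _ v.1 _ v.2).2 ⟨a, rfl⟩⟩
  exact saturation ▸ isOpen_iUnion fun a => hU.preimage (continuous_scale a)

instance projT2Space : T2Space (ℙ ℂ (Fin n → ℂ)) := by
  rw [t2Space_iff_of_isOpenQuotientMap isOpenQuotientMap_projMk]
  simp only [Projectivization.mk'_eq_mk, mk_eq_mk_iff_minors, Set.ofPred_forall]
  refine isClosed_iInter fun i => isClosed_iInter fun j => isClosed_eq ?_ ?_
  · exact ((continuous_coord i).comp continuous_fst).mul ((continuous_coord j).comp continuous_snd)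
  · exact ((continuous_coord j).comp continuous_fst).mul ((continuous_coord i).comp continuous_snd)

instance projSecondCountable : SecondCountableTopology (ℙ ℂ (Fin n → ℂ)) :=
  isOpenQuotientMap_projMk.isQuotientMap.secondCountableTopology isOpenQuotientMap_projMk.isOpenMap

theorem continuous_proj_smul (g : GLin n) : Continuous fun p : ℙ ℂ (Fin n → ℂ) => g • p := by
  rw [← isOpenQuotientMap_projMk.continuous_comp_iff]
  exact continuous_projMk.comp ((g.toLinearMap.continuous_of_finiteDimensional.comp
    continuous_subtype_val).subtype_mk fun v => (smul_ne_zero_iff_ne g).2 v.2)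

theorem eventually_mk_mem {U : Set (ℙ ℂ (Fin n → ℂ))} (hU : IsOpen U) {v : Fin n → ℂ} (hv : v ≠ 0)
    (hvU : Projectivization.mk ℂ v hv ∈ U) :
    ∀ᶠ w in 𝓝 v, ∀ hw : w ≠ 0, Projectivization.mk ℂ w hw ∈ U := by
  have h : ∀ᶠ w : {v : Fin n → ℂ // v ≠ 0} in 𝓝 ⟨v, hv⟩, Projectivization.mk' ℂ w ∈ U :=
    (hU.preimage continuous_projMk).mem_nhds hvU
  rw [nhds_subtype_eq_comap, Filter.eventually_comap] at h
  filter_upwards [h] with w hw hw0 using hw ⟨w, hw0⟩ rfl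

theorem isOpen_rep_apply_ne_zero (l : Fin n) : IsOpen {p : ℙ ℂ (Fin n → ℂ) | p.rep l ≠ 0} := by
  have preimage_eq :
      Projectivization.mk' ℂ ⁻¹' {p : ℙ ℂ (Fin n → ℂ) | p.rep l ≠ 0} = {v | v.1 l ≠ 0} := by
    ext v
    simp [mk_rep_apply_eq_zero_iff]
  rw [← isOpenQuotientMap_projMk.isQuotientMap.isOpen_preimage, preimage_eq]
  exact isOpen_ne_fun (continuous_coord l) continuous_const

theorem continuousOn_coordRatio (r l : Fin n) :
    ContinuousOn (coordRatio r l) {p : ℙ ℂ (Fin n → ℂ) | p.rep l ≠ 0} := by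
  intro p hp
  obtain ⟨v, rfl⟩ := isOpenQuotientMap_projMk.surjective p
  have hl : v.1 l ≠ 0 := by simpa [mk_rep_apply_eq_zero_iff] using hp
  have comp_eq : (coordRatio r l ∘ Projectivization.mk' ℂ) =
      fun v : {v : Fin n → ℂ // v ≠ 0} => v.1 r / v.1 l := by
    ext v
    simp
  refine ContinuousAt.continuousWithinAt ?_
  rw [← isOpenQuotientMap_projMk.continuousAt_comp_iff, comp_eq]
  exact (continuous_coord r).continuousAt.div (continuous_coord l).continuousAt hl

theorem diag_smul_eq_self_iff {t : Fin n → ℂˣ} {p : ℙ ℂ (Fin n → ℂ)} :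
    diag t • p = p ↔ ∀ i j, p.rep i ≠ 0 → p.rep j ≠ 0 → t i = t j := by
  have smul_eq : diag t • p = Projectivization.mk ℂ (diag t p.rep)
      ((smul_ne_zero_iff_ne (diag t)).2 p.rep_nonzero) := by
    conv_lhs => rw [← p.mk_rep]
    rfl
  conv_lhs => rw [smul_eq]; rhs; rw [← p.mk_rep]
  rw [mk_eq_mk_iff_minors]
  refine forall₂_congr fun i j => ?_
  rw [diag_apply, diag_apply, mul_assoc, mul_right_comm, mul_assoc (t j : ℂ),
    mul_comm (p.rep i) (p.rep j), mul_eq_mul_right_iff, mul_eq_zero, Units.val_inj]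
  tauto

end Projective

/-! ### The symmetry group as the image of a finite torus -/

section Torus

theorem diag_mul {n : ℕ} (s t : Fin n → ℂˣ) : diag (s * t) = diag s * diag t := by
  ext x i
  simp [mul_assoc]

theorem diag_one {n : ℕ} : diag (1 : Fin n → ℂˣ) = 1 := by
  ext x i
  simp

/-- The diagonal matrices with entries `N`-th roots of unity that act on the Fermat surface
through `H`. -/
def torus (N : ℕ) : Subgroup (Fin 4 → ℂˣ) where
  carrier := {t | (∀ i, t i ^ N = 1) ∧ t 0 * t 1 = t 2 * t 3}
  mul_mem' := by
    rintro s t ⟨hs, hs'⟩ ⟨ht, ht'⟩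
    refine ⟨fun i => by rw [Pi.mul_apply, mul_pow, hs, ht, one_mul], ?_⟩
    simp only [Pi.mul_apply]
    rw [mul_mul_mul_comm, hs', ht', mul_mul_mul_comm]
  one_mem' := by simp
  inv_mem' := by
    rintro t ⟨ht, ht'⟩
    refine ⟨fun i => by rw [Pi.inv_apply, inv_pow, ht, inv_one], ?_⟩
    simp only [Pi.inv_apply]
    rw [← mul_inv, ht', mul_inv]

variable {N : ℕ}

theorem torus_pow_two_mul {t : Fin 4 → ℂˣ} (ht : t ∈ torus N) (i : Fin 4) :
    (t i : ℂ) ^ (2 * N) = 1 := by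
  rw [mul_comm, pow_mul, ← Units.val_pow_eq_pow_val, ht.1 i, Units.val_one, one_pow]

instance finite_torus [NeZero N] : Finite (torus N) := by
  have finite_roots : (rootsOfUnity N ℂ : Set ℂˣ).Finite :=
    inferInstanceAs (Finite (rootsOfUnity N ℂ))
  exact ((Set.Finite.pi' fun _ => finite_roots).subset fun t ht => ht.1).to_subtype

/-- The action of the finite torus on the Fermat surface. -/
def torusAut (N : ℕ) : torus N →* Equiv.Perm (Fermat N) where
  toFun t := diagAut N t.1 (torus_pow_two_mul t.2)
  map_one' := by
    ext p
    change diag (1 : Fin 4 → ℂˣ) • p.1 = p.1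
    rw [diag_one, one_smul]
  map_mul' s t := by
    ext p
    change diag (s.1 * t.1) • p.1 = diag s.1 • diag t.1 • p.1
    rw [diag_mul, mul_smul]

theorem torusAut_apply (t : torus N) (p : Fermat N) : (torusAut N t p).1 = diag t.1 • p.1 := rfl

theorem torusAut_apply_eq_self_iff {t : torus N} {p : Fermat N} :
    torusAut N t p = p ↔ ∀ i j, p.1.rep i ≠ 0 → p.1.rep j ≠ 0 → t.1 i = t.1 j :=
  Subtype.ext_iff.trans diag_smul_eq_self_iff

theorem torusAut_eq_of_eq_const_mul {s t : torus N} {u : ℂˣ} (h : ∀ i, t.1 i = u * s.1 i) :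
    torusAut N t = torusAut N s := by
  rw [← inv_mul_eq_one, ← map_inv, ← map_mul]
  ext1 p
  exact torusAut_apply_eq_self_iff.2 fun i j _ _ => by simp [h]

theorem omega_pow_eq_one [NeZero N] : omega N ^ N = 1 :=
  Units.ext (by simpa using (isPrimitiveRoot_omega (NeZero.ne N)).pow_eq_one)

theorem exists_omega_pow_eq [NeZero N] {u : ℂˣ} (hu : u ^ N = 1) : ∃ k : ℕ, omega N ^ k = u := by
  obtain ⟨k, -, hk⟩ := (isPrimitiveRoot_omega (NeZero.ne N)).eq_pow_of_pow_eq_one (ξ := (u : ℂ)) (by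
    rw [← Units.val_pow_eq_pow_val, hu, Units.val_one])
  exact ⟨k, Units.ext (by simpa using hk)⟩

theorem H_eq_range [NeZero N] : H N = (torusAut N).range := by
  have hω : omega N ^ N = 1 := omega_pow_eq_one
  let t₀ : torus N := ⟨![omega N, 1, omega N, 1], fun i => by fin_cases i <;> simp [hω], by simp⟩
  let t₁ : torus N := ⟨![omega N, 1, 1, omega N], fun i => by fin_cases i <;> simp [hω], by simp⟩
  apply le_antisymm
  · rw [H, Subgroup.closure_le]
    rintro g (rfl | rfl)
    exacts [⟨t₀, rfl⟩, ⟨t₁, rfl⟩]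
  · rintro _ ⟨t, rfl⟩
    have ratio_pow (i : Fin 4) : (t.1 i / t.1 1) ^ N = 1 := by
      rw [div_pow, t.2.1, t.2.1, div_one]
    obtain ⟨i, hi⟩ := exists_omega_pow_eq (ratio_pow 2)
    obtain ⟨j, hj⟩ := exists_omega_pow_eq (ratio_pow 3)
    have eq_word : torusAut N t = V₀ N ^ i * V₁ N ^ j := by
      have word_eq : V₀ N ^ i * V₁ N ^ j = torusAut N (t₀ ^ i * t₁ ^ j) := by
        rw [map_mul, map_pow, map_pow]
        rfl
      rw [word_eq]
      have apply_zero : t.1 1 * (t.1 2 / t.1 1 * (t.1 3 / t.1 1)) = t.1 0 := by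
        rw [← mul_assoc, mul_div_cancel, ← mul_div_assoc, ← t.2.2, mul_div_cancel_right]
      refine torusAut_eq_of_eq_const_mul (u := t.1 1) fun r => ?_
      fin_cases r <;> simp [t₀, t₁, hi, hj, apply_zero]
    rw [eq_word]
    exact mul_mem (pow_mem (Subgroup.subset_closure (by simp)) _)
      (pow_mem (Subgroup.subset_closure (by simp)) _)

variable [NeZero N]

theorem exists_torusAut_eq_smul (h : H N) :
    ∃ t : torus N, ∀ p : Fermat N, h • p = torusAut N t p := by
  obtain ⟨t, ht⟩ := H_eq_range.le h.2
  exact ⟨t, fun p => by rw [ht]; rfl⟩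

theorem exists_smul_eq_torusAut (t : torus N) : ∃ h : H N, ∀ p : Fermat N, h • p = torusAut N t p :=
  ⟨⟨torusAut N t, H_eq_range.ge ⟨t, rfl⟩⟩, fun _ => rfl⟩

instance finite_H : Finite (H N) := by
  rw [H_eq_range]
  exact Set.finite_range (torusAut N)

instance continuousConstSMul_H : ContinuousConstSMul (H N) (Fermat N) where
  continuous_const_smul h := by
    obtain ⟨t, ht⟩ := exists_torusAut_eq_smul h
    simp only [ht]
    exact ((continuous_proj_smul (diag t.1)).comp continuous_subtype_val).subtype_mk _

theorem actsHolomorphically_H : ActsHolomorphically (H N) (Fermat N) := by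
  refine ActsHolomorphically.of_holAt_smul fun h p f hf v hv hvp => ?_
  obtain ⟨t, ht⟩ := exists_torusAut_eq_smul h
  obtain ⟨g, hg, hgf⟩ := hf (diag t.1 v) ((smul_ne_zero_iff_ne (diag t.1)).2 hv) (by
    rw [ht, torusAut_apply, ← hvp]; rfl)
  have analytic := analyticAt_linear (diag t.1) v
  refine ⟨fun w => g (diag t.1 w), AnalyticAt.comp (g := g) hg analytic, ?_⟩
  filter_upwards [analytic.continuousAt.eventually hgf] with w hw hw0 hwZ
  rw [ht]
  exact hw ((smul_ne_zero_iff_ne (diag t.1)).2 hw0) (torusAut N t ⟨_, hwZ⟩).2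

end Torus

/-! ### Local parametrizations of the Fermat surface -/

section ProjectiveParametrizations

theorem isLocalParam_of_analytic {m n : ℕ} {Z : Set (ℙ ℂ (Fin n → ℂ))}
    {e : OpenPartialHomeomorph (Fin m → ℂ) Z} {Φ : (Fin m → ℂ) → Fin n → ℂ} (hΦ : ∀ x, Φ x ≠ 0)
    (hΦan : ∀ x ∈ e.source, AnalyticAt ℂ Φ x)
    (he : ∀ x ∈ e.source, (e x).1 = Projectivization.mk ℂ (Φ x) (hΦ x))
    {Ψ : (Fin n → ℂ) → Fin m → ℂ}
    (hΨan : ∀ v hv, ∀ q ∈ e.target, q.1 = Projectivization.mk ℂ v hv → AnalyticAt ℂ Ψ v)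
    (he' : ∀ v hv, ∀ q ∈ e.target, q.1 = Projectivization.mk ℂ v hv → e.symm q = Ψ v) :
    IsLocalParam e := by
  intro x hx f
  constructor
  · intro hf
    obtain ⟨g, hg, hfg⟩ := hf (Φ x) (hΦ x) (he x hx).symm
    refine (AnalyticAt.comp (g := g) hg (hΦan x hx)).congr ?_
    filter_upwards [(hΦan x hx).continuousAt.eventually hfg, e.open_source.mem_nhds hx]
      with y hy hyx
    rw [Function.comp_apply, ← hy (hΦ y) (he y hyx ▸ (e y).2)]
    exact congrArg f (Subtype.ext (he y hyx).symm)
  · intro hf v hv hvx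
    have Ψ_apply : Ψ v = x := by
      rw [← he' v hv (e x) (e.map_source hx) hvx.symm, e.left_inv hx]
    refine ⟨fun w => f (e (Ψ w)), AnalyticAt.comp (g := fun z => f (e z)) (Ψ_apply ▸ hf)
      (hΨan v hv (e x) (e.map_source hx) hvx.symm), ?_⟩
    obtain ⟨O, hO, hOe⟩ := isOpen_induced_iff.1 e.open_target
    have mem_target_iff (q : Z) : q ∈ e.target ↔ q.1 ∈ O := by rw [← hOe]; rfl
    filter_upwards [eventually_mk_mem hO hv (hvx ▸ (mem_target_iff _).1 (e.map_source hx))]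
      with w hw hw0 hwZ
    have hwt := (mem_target_iff ⟨_, hwZ⟩).2 (hw hw0)
    rw [← he' w hw0 _ hwt rfl, e.right_inv hwt]

end ProjectiveParametrizations

section Fermat

/-- The signs of the coordinates in the equation of the Fermat surface. -/
def fermatSign : Fin 4 → ℂ := ![1, -1, 1, -1]

theorem fermatSign_mul_self (r : Fin 4) : fermatSign r * fermatSign r = 1 := by
  fin_cases r <;> simp [fermatSign]

variable {N : ℕ}

theorem mk_mem_projZeros_fermatEq {v : Fin 4 → ℂ} (hv : v ≠ 0) :
    Projectivization.mk ℂ v hv ∈ projZeros (fermatEq N) ↔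
      ∑ r, fermatSign r * v r ^ (2 * N) = 0 := by
  obtain ⟨a, ha⟩ := Projectivization.exists_smul_eq_mk_rep ℂ v hv
  have ha0 : (a : ℂ) ^ (2 * N) ≠ 0 := pow_ne_zero _ a.ne_zero
  simp only [projZeros, fermatEq, Set.mem_ofPred_eq, Fin.forall_fin_one, Matrix.cons_val_fin_one,
    map_sub, map_add, map_pow, MvPolynomial.eval_X, ← ha, Pi.smul_apply, Units.smul_def,
    smul_eq_mul, mul_pow, ← mul_add, ← mul_sub, mul_eq_zero, ha0, false_or]
  simp only [Fin.sum_univ_four, fermatSign, Matrix.cons_val]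
  constructor <;> intro h <;> linear_combination h

/-- A branch of the `n`-th root: a local inverse `P.symm`, holomorphic, of the `n`-th power map. -/
structure IsRootBranch (n : ℕ) (P : OpenPartialHomeomorph ℂ ℂ) : Prop where
  apply_eq_pow : ∀ z, P z = z ^ n
  analyticAt_symm : ∀ w ∈ P.target, AnalyticAt ℂ P.symm w

theorem exists_isRootBranch {n : ℕ} (hn : n ≠ 0) {a : ℂ} (ha : a ≠ 0) :
    ∃ P : OpenPartialHomeomorph ℂ ℂ, IsRootBranch n P ∧ a ∈ P.source := by
  have deriv_ne_zero {z : ℂ} (hz : z ≠ 0) : (n : ℂ) * z ^ (n - 1) ≠ 0 :=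
    mul_ne_zero (Nat.cast_ne_zero.2 hn) (pow_ne_zero _ hz)
  have hderiv := (hasStrictDerivAt_pow n a).hasStrictFDerivAt_equiv (deriv_ne_zero ha)
  let P := (hderiv.toOpenPartialHomeomorph (fun z : ℂ => z ^ n)).restrOpen {0}ᶜ
    isOpen_compl_singleton
  refine ⟨P, ⟨fun z => rfl, fun w hw => ?_⟩, hderiv.mem_toOpenPartialHomeomorph_source, ha⟩
  exact ContDiffAt.analyticAt (P.contDiffAt_symm_deriv (deriv_ne_zero (P.map_target hw).2) hw
    (hasDerivAt_pow n _) (contDiff_id.pow n).contDiffAt)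

/-- The vector with coordinates `x 0, x 1, 1, ζ` at the places `s 0, s 1, s 2, s 3`. The
permutation `s` selects an affine chart of projective space, with affine coordinates `x`, and the
coordinate `ζ` that is to be eliminated. -/
def chartVec (s : Equiv.Perm (Fin 4)) (x : Fin 2 → ℂ) (ζ : ℂ) : Fin 4 → ℂ :=
  fun r => ![x 0, x 1, 1, ζ] (s.symm r)

variable (s : Equiv.Perm (Fin 4))

theorem chartVec_apply (x : Fin 2 → ℂ) (ζ : ℂ) (k : Fin 4) :
    chartVec s x ζ (s k) = ![x 0, x 1, 1, ζ] k := by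
  simp [chartVec]

theorem chartVec_ne_zero (x : Fin 2 → ℂ) (ζ : ℂ) : chartVec s x ζ ≠ 0 :=
  Function.ne_iff.2 ⟨s 2, by simp [chartVec_apply]⟩

/-- The affine coordinates of a point in the chart of projective space selected by `s`. -/
def affineCoords (p : ℙ ℂ (Fin 4 → ℂ)) : Fin 2 → ℂ :=
  ![coordRatio (s 0) (s 2) p, coordRatio (s 1) (s 2) p]

theorem affineCoords_mk {v : Fin 4 → ℂ} (hv : v ≠ 0) :
    affineCoords s (Projectivization.mk ℂ v hv) = ![v (s 0) / v (s 2), v (s 1) / v (s 2)] := by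
  simp only [affineCoords, coordRatio_mk]

theorem affineCoords_chartVec (x : Fin 2 → ℂ) (ζ : ℂ) :
    affineCoords s (Projectivization.mk ℂ _ (chartVec_ne_zero s x ζ)) = x := by
  ext i
  fin_cases i <;> simp [affineCoords_mk, chartVec_apply]

theorem mk_chartVec_affineCoords {p : ℙ ℂ (Fin 4 → ℂ)} (hp : p.rep (s 2) ≠ 0) :
    Projectivization.mk ℂ _
      (chartVec_ne_zero s (affineCoords s p) (coordRatio (s 3) (s 2) p)) = p := by
  conv_rhs => rw [← p.mk_rep]
  rw [Projectivization.mk_eq_mk_iff']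
  refine ⟨(p.rep (s 2))⁻¹, ?_⟩
  ext r
  obtain ⟨k, rfl⟩ := s.surjective r
  rw [chartVec_apply]
  fin_cases k <;> simp [affineCoords, coordRatio, hp, div_eq_inv_mul]

variable (N) in
/-- The value that the equation of the Fermat surface prescribes for `ζ ^ (2 * N)` at the point with
homogeneous coordinates `chartVec s x ζ`. -/
def lastPow (x : Fin 2 → ℂ) : ℂ :=
  -fermatSign (s 3) * (fermatSign (s 0) * x 0 ^ (2 * N) + fermatSign (s 1) * x 1 ^ (2 * N) +
    fermatSign (s 2))

theorem analyticAt_lastPow (x : Fin 2 → ℂ) : AnalyticAt ℂ (lastPow N s) x :=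
  analyticAt_const.mul (((analyticAt_const.mul ((analyticAt_coord 0 x).pow _)).add
    (analyticAt_const.mul ((analyticAt_coord 1 x).pow _))).add analyticAt_const)

theorem chartVec_mem_iff {x : Fin 2 → ℂ} {ζ : ℂ} :
    Projectivization.mk ℂ _ (chartVec_ne_zero s x ζ) ∈ projZeros (fermatEq N) ↔
      ζ ^ (2 * N) = lastPow N s x := by
  rw [mk_mem_projZeros_fermatEq, ← Equiv.sum_comp s, Fin.sum_univ_four]
  simp only [chartVec_apply, lastPow, Matrix.cons_val, one_pow, mul_one]
  have sign_sq := fermatSign_mul_self (s 3)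
  constructor <;> intro h
  · linear_combination fermatSign (s 3) * h - ζ ^ (2 * N) * sign_sq
  · linear_combination fermatSign (s 3) * h - (fermatSign (s 0) * x 0 ^ (2 * N) +
      fermatSign (s 1) * x 1 ^ (2 * N) + fermatSign (s 2)) * sign_sq

theorem coordRatio_pow_eq_lastPow {p : Fermat N} (hp : p.1.rep (s 2) ≠ 0) :
    coordRatio (s 3) (s 2) p.1 ^ (2 * N) = lastPow N s (affineCoords s p.1) := by
  rw [← chartVec_mem_iff, mk_chartVec_affineCoords s hp]
  exact p.2

theorem isOpen_fermat_rep_ne_zero (l : Fin 4) : IsOpen {q : Fermat N | q.1.rep l ≠ 0} :=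
  (isOpen_rep_apply_ne_zero l).preimage continuous_subtype_val

theorem continuousOn_fermat_coordRatio (r l : Fin 4) :
    ContinuousOn (fun q : Fermat N => coordRatio r l q.1) {q | q.1.rep l ≠ 0} :=
  (continuousOn_coordRatio r l).comp continuous_subtype_val.continuousOn fun _ hq => hq

variable {P : OpenPartialHomeomorph ℂ ℂ}

theorem analyticAt_chartVec_branch (hP : IsRootBranch (2 * N) P) {x : Fin 2 → ℂ}
    (hx : lastPow N s x ∈ P.target) :
    AnalyticAt ℂ (fun x => chartVec s x (P.symm (lastPow N s x))) x := by
  refine analyticAt_pi_iff.2 fun r => ?_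
  obtain ⟨k, rfl⟩ := s.surjective r
  simp only [chartVec_apply]
  fin_cases k
  exacts [analyticAt_coord 0 x, analyticAt_coord 1 x, analyticAt_const,
    AnalyticAt.comp (g := P.symm) (hP.analyticAt_symm _ hx) (analyticAt_lastPow s x)]

open Classical in
/-- The map `x ↦ [chartVec s x ζ]` into the Fermat surface with `ζ` given by the branch `P.symm` of
the root; where that branch is not defined the value is the arbitrary point `p`. -/
def branchPoint (hP : IsRootBranch (2 * N) P) (p : Fermat N) (x : Fin 2 → ℂ) : Fermat N :=
  if h : lastPow N s x ∈ P.target then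
    ⟨Projectivization.mk ℂ _ (chartVec_ne_zero s x (P.symm (lastPow N s x))), by
      rw [chartVec_mem_iff, ← hP.apply_eq_pow, P.right_inv h]⟩
  else p

theorem branchPoint_coe (hP : IsRootBranch (2 * N) P) (p : Fermat N) {x : Fin 2 → ℂ}
    (hx : lastPow N s x ∈ P.target) : (branchPoint s hP p x).1 =
      Projectivization.mk ℂ _ (chartVec_ne_zero s x (P.symm (lastPow N s x))) := by
  rw [branchPoint, dif_pos hx]

theorem continuousOn_branchPoint (hP : IsRootBranch (2 * N) P) (p : Fermat N) :
    ContinuousOn (branchPoint s hP p) {x | lastPow N s x ∈ P.target} := by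
  rw [Topology.IsInducing.subtypeVal.continuousOn_iff]
  have continuousOn_vec : ContinuousOn (fun x => (⟨_, chartVec_ne_zero s x
      (P.symm (lastPow N s x))⟩ : {v : Fin 4 → ℂ // v ≠ 0})) {x | lastPow N s x ∈ P.target} :=
    Topology.IsInducing.subtypeVal.continuousOn_iff.2 fun x hx =>
      (analyticAt_chartVec_branch s hP hx).continuousAt.continuousWithinAt
  exact (continuous_projMk.comp_continuousOn continuousOn_vec).congr fun x hx =>
    branchPoint_coe s hP p hx

theorem lastPow_affineCoords_mem (hP : IsRootBranch (2 * N) P) {q : Fermat N}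
    (hq : q.1.rep (s 2) ≠ 0) (hqP : coordRatio (s 3) (s 2) q.1 ∈ P.source) :
    lastPow N s (affineCoords s q.1) ∈ P.target := by
  rw [← coordRatio_pow_eq_lastPow s hq, ← hP.apply_eq_pow]
  exact P.map_source hqP

theorem branchPoint_affineCoords (hP : IsRootBranch (2 * N) P) (p : Fermat N) {q : Fermat N}
    (hq : q.1.rep (s 2) ≠ 0) (hqP : coordRatio (s 3) (s 2) q.1 ∈ P.source) :
    branchPoint s hP p (affineCoords s q.1) = q := by
  refine Subtype.ext ?_
  rw [branchPoint_coe s hP p (lastPow_affineCoords_mem s hP hq hqP)]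
  simp only [← coordRatio_pow_eq_lastPow s hq, ← hP.apply_eq_pow, P.left_inv hqP]
  exact mk_chartVec_affineCoords s hq

/-- The parametrization of an open subset of the Fermat surface by affine coordinates. -/
def fermatParam (hP : IsRootBranch (2 * N) P) (p : Fermat N) :
    OpenPartialHomeomorph (Fin 2 → ℂ) (Fermat N) where
  toFun := branchPoint s hP p
  invFun q := affineCoords s q.1
  source := {x | lastPow N s x ∈ P.target}
  target := {q | q.1.rep (s 2) ≠ 0} ∩ {q | coordRatio (s 3) (s 2) q.1 ∈ P.source}
  map_source' x hx := by
    refine ⟨?_, ?_⟩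
    · rw [Set.mem_ofPred_eq, branchPoint_coe s hP p hx, ne_eq, mk_rep_apply_eq_zero_iff,
        chartVec_apply]
      exact one_ne_zero
    · rw [Set.mem_ofPred_eq, branchPoint_coe s hP p hx, coordRatio_mk, chartVec_apply,
        chartVec_apply]
      simpa using P.map_target hx
  map_target' q hq := lastPow_affineCoords_mem s hP hq.1 hq.2
  left_inv' x hx := by rw [branchPoint_coe s hP p hx, affineCoords_chartVec]
  right_inv' q hq := branchPoint_affineCoords s hP p hq.1 hq.2
  open_source := P.open_target.preimage
    (continuous_iff_continuousAt.2 fun x => (analyticAt_lastPow s x).continuousAt)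
  open_target := (continuousOn_fermat_coordRatio (s 3) (s 2)).isOpen_inter_preimage
    (isOpen_fermat_rep_ne_zero (s 2)) P.open_source
  continuousOn_toFun := continuousOn_branchPoint s hP p
  continuousOn_invFun := continuousOn_pi.2 fun k => by
    fin_cases k
    exacts [(continuousOn_fermat_coordRatio (s 0) (s 2)).mono Set.inter_subset_left,
      (continuousOn_fermat_coordRatio (s 1) (s 2)).mono Set.inter_subset_left]

theorem isLocalParam_fermatParam (hP : IsRootBranch (2 * N) P) (p : Fermat N) :
    IsLocalParam (fermatParam s hP p) := by
  refine isLocalParam_of_analytic (fun x => chartVec_ne_zero s x (P.symm (lastPow N s x)))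
    (Ψ := fun v => ![v (s 0) / v (s 2), v (s 1) / v (s 2)])
    (fun x hx => analyticAt_chartVec_branch s hP hx) (fun x hx => branchPoint_coe s hP p hx)
    (fun v hv q hq hqv => ?_) (fun v hv q _ hqv => ?_)
  · have hv2 : v (s 2) ≠ 0 := by
      rw [ne_eq, ← mk_rep_apply_eq_zero_iff _ hv, ← hqv]
      exact hq.1
    refine analyticAt_pi_iff.2 fun k => ?_
    fin_cases k
    exacts [(analyticAt_coord (s 0) v).div (analyticAt_coord (s 2) v) hv2,
      (analyticAt_coord (s 1) v).div (analyticAt_coord (s 2) v) hv2]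
  · change affineCoords s q.1 = _
    rw [hqv, affineCoords_mk]

theorem exists_isRootBranch_mem_target [NeZero N] {p : Fermat N} (h2 : p.1.rep (s 2) ≠ 0)
    (h3 : p.1.rep (s 3) ≠ 0) : ∃ (P : OpenPartialHomeomorph ℂ ℂ) (hP : IsRootBranch (2 * N) P),
      p ∈ (fermatParam s hP p).target := by
  obtain ⟨P, hP, hmem⟩ := exists_isRootBranch (n := 2 * N) (by simp [NeZero.ne])
    (a := coordRatio (s 3) (s 2) p.1) (div_ne_zero h3 h2)
  exact ⟨P, hP, h2, hmem⟩

end Fermat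

/-! ### The singular points of the degenerate fibres -/

section VanishingPairs

variable {N : ℕ}

theorem exists_perm_apply_eq : ∀ i j l : Fin 4, i ≠ j → l ≠ i → l ≠ j →
    ∃ s : Equiv.Perm (Fin 4), s 0 = i ∧ s 1 = j ∧ s 2 = l := by
  decide

theorem rep_sq_add_rep_sq (p : Fermat N) :
    (p.1.rep 0 ^ N) ^ 2 + (p.1.rep 2 ^ N) ^ 2 = (p.1.rep 1 ^ N) ^ 2 + (p.1.rep 3 ^ N) ^ 2 := by
  have h := (mk_mem_projZeros_fermatEq p.1.rep_nonzero).1 (p.1.mk_rep.symm ▸ p.2)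
  simp only [Fin.sum_univ_four, fermatSign, Matrix.cons_val, mul_comm 2 N, pow_mul] at h
  linear_combination h

theorem rep_ne_zero_of_pair [NeZero N] (p : Fermat N) {i j l : Fin 4} (hij : i ≠ j)
    (hi : p.1.rep i = 0) (hj : p.1.rep j = 0) (hli : l ≠ i) (hlj : l ≠ j) : p.1.rep l ≠ 0 := by
  intro hl
  obtain ⟨s, rfl, rfl, rfl⟩ := exists_perm_apply_eq i j l hij hli hlj
  have sum_eq_zero := (mk_mem_projZeros_fermatEq p.1.rep_nonzero).1 (p.1.mk_rep.symm ▸ p.2)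
  rw [← Equiv.sum_comp s, Fin.sum_univ_four, hi, hj, hl] at sum_eq_zero
  have sign_ne_zero := left_ne_zero_of_mul_eq_one (fermatSign_mul_self (s 3))
  have h3 : p.1.rep (s 3) = 0 := by simpa [NeZero.ne, sign_ne_zero] using sum_eq_zero
  refine p.1.rep_nonzero (funext fun r => ?_)
  obtain ⟨k, rfl⟩ := s.surjective r
  fin_cases k
  exacts [hi, hj, hl, h3]

/-- The pairs of coordinates whose common zeros on the Fermat surface are the singular points of the
fibres over `k' = 0, ∞`. -/
def IsScalarPair (i j : Fin 4) : Prop :=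
  (i = 0 ∧ j = 2) ∨ (i = 0 ∧ j = 3) ∨ (i = 1 ∧ j = 2) ∨ (i = 1 ∧ j = 3)

/-- The pairs of coordinates whose common zeros on the Fermat surface are the singular points of the
fibres over `k' = ±1`. -/
def IsTypeAPair (i j : Fin 4) : Prop := (i = 0 ∧ j = 1) ∨ (i = 2 ∧ j = 3)

theorem IsScalarPair.ne {i j : Fin 4} (hij : IsScalarPair i j) : i ≠ j := by
  rcases hij with ⟨rfl, rfl⟩ | ⟨rfl, rfl⟩ | ⟨rfl, rfl⟩ | ⟨rfl, rfl⟩ <;> decide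

theorem IsTypeAPair.ne {i j : Fin 4} (hij : IsTypeAPair i j) : i ≠ j := by
  rcases hij with ⟨rfl, rfl⟩ | ⟨rfl, rfl⟩ <;> decide

theorem isScalarPair_or_isTypeAPair_of_ne : ∀ {i j : Fin 4}, i ≠ j →
    (IsScalarPair i j ∨ IsTypeAPair i j) ∨ IsScalarPair j i ∨ IsTypeAPair j i := by
  unfold IsScalarPair IsTypeAPair
  decide

/-- Two homogeneous coordinates `i`, `j` with `P i j` vanish at the point `p`, where `P`
specifies the kind of pair. -/
def HasVanishingPair (P : Fin 4 → Fin 4 → Prop) (p : Fermat N) : Prop :=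
  ∃ i j, P i j ∧ p.1.rep i = 0 ∧ p.1.rep j = 0

theorem hasVanishingPair_ne_iff {p : Fermat N} : HasVanishingPair (· ≠ ·) p ↔
    HasVanishingPair IsScalarPair p ∨ HasVanishingPair IsTypeAPair p := by
  constructor
  · rintro ⟨i, j, hij, hi, hj⟩
    rcases isScalarPair_or_isTypeAPair_of_ne hij with (h | h) | (h | h)
    exacts [Or.inl ⟨i, j, h, hi, hj⟩, Or.inr ⟨i, j, h, hi, hj⟩, Or.inl ⟨j, i, h, hj, hi⟩,
      Or.inr ⟨j, i, h, hj, hi⟩]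
  · rintro (⟨i, j, hij, h⟩ | ⟨i, j, hij, h⟩)
    exacts [⟨i, j, hij.ne, h⟩, ⟨i, j, hij.ne, h⟩]

theorem exists_perm_of_not_hasVanishingPair {p : Fermat N} (hp : ¬ HasVanishingPair (· ≠ ·) p) :
    ∃ s : Equiv.Perm (Fin 4), ∀ k, k ≠ 0 → p.1.rep (s k) ≠ 0 := by
  by_cases h : ∃ i, p.1.rep i = 0
  · obtain ⟨i, hi⟩ := h
    refine ⟨Equiv.swap 0 i, fun k hk hk0 => hp ⟨i, _, fun hik => hk ?_, hi, hk0⟩⟩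
    rwa [eq_comm, Equiv.swap_apply_eq_iff, Equiv.swap_apply_right] at hik
  · exact ⟨1, fun k _ hk => h ⟨k, hk⟩⟩

theorem exists_perm_of_hasVanishingPair [NeZero N] {P : Fin 4 → Fin 4 → Prop}
    (hP : ∀ {i j}, P i j → i ≠ j) {p : Fermat N} (hp : HasVanishingPair P p) :
    ∃ s : Equiv.Perm (Fin 4), P (s 0) (s 1) ∧ p.1.rep (s 0) = 0 ∧ p.1.rep (s 1) = 0 ∧
      p.1.rep (s 2) ≠ 0 ∧ p.1.rep (s 3) ≠ 0 := by
  obtain ⟨i, j, hij, hi, hj⟩ := hp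
  have third : ∀ i j : Fin 4, ∃ l, l ≠ i ∧ l ≠ j := by decide
  obtain ⟨l, hli, hlj⟩ := third i j
  obtain ⟨s, rfl, rfl, -⟩ := exists_perm_apply_eq i j l (hP hij) hli hlj
  have rep_ne_zero (l : Fin 4) := rep_ne_zero_of_pair (l := l) p (hP hij) hi hj
  exact ⟨s, hij, hi, hj, rep_ne_zero _ (by simp) (by simp), rep_ne_zero _ (by simp) (by simp)⟩

theorem exists_perm_rep_ne_zero [NeZero N] (p : Fermat N) :
    ∃ s : Equiv.Perm (Fin 4), p.1.rep (s 2) ≠ 0 ∧ p.1.rep (s 3) ≠ 0 := by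
  by_cases hp : HasVanishingPair (· ≠ ·) p
  · obtain ⟨s, -, -, -, h⟩ := exists_perm_of_hasVanishingPair id hp
    exact ⟨s, h⟩
  · obtain ⟨s, hs⟩ := exists_perm_of_not_hasVanishingPair hp
    exact ⟨s, hs 2 (by decide), hs 3 (by decide)⟩

end VanishingPairs

section Fibres

theorem minor_eq_zero_of_rank_lt_two {K : Type*} [Field K] {m n : ℕ} {A : Matrix (Fin m) (Fin n) K}
    (h : A.rank < 2) (r r' : Fin m) (j j' : Fin n) : A r j * A r' j' = A r j' * A r' j := by
  by_contra hne
  have isUnit_minor : IsUnit (A.submatrix ![r, r'] ![j, j']) := by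
    rw [Matrix.isUnit_iff_isUnit_det, isUnit_iff_ne_zero, Matrix.det_fin_two]
    simpa [sub_eq_zero] using hne
  have rank_minor := Matrix.rank_of_isUnit _ isUnit_minor
  rw [Fintype.card_fin] at rank_minor
  exact (rank_minor.symm.le.trans (Matrix.rank_submatrix_le A ![r, r'] ![j, j'])).not_gt h

/-- The matrix of the equations of the rapidity curve, which are linear in the `N`-th powers of the
coordinates. -/
def rapidityMatrix (κ : Param) : Matrix (Fin 4) (Fin 4) ℂ :=
  !![κ.k, 0, κ.k', -κ.k₀; 0, κ.k, -κ.k₀, κ.k'; κ.k₀, κ.k', 0, -κ.k; κ.k', κ.k₀, -κ.k, 0]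

variable {N : ℕ} {κ : Param}

theorem eval_rapidityEqs (v : Fin 4 → ℂ) (r : Fin 4) :
    MvPolynomial.eval v (rapidityEqs N κ r) = ∑ j, rapidityMatrix κ r j * v j ^ N := by
  rw [Fin.sum_univ_four]
  fin_cases r <;> simp [rapidityEqs, rapidityMatrix] <;> ring

theorem jacobian_rapidityEqs (v : Fin 4 → ℂ) (r j : Fin 4) :
    jacobian (rapidityEqs N κ) v r j = rapidityMatrix κ r j * (N * v j ^ (N - 1)) := by
  fin_cases r <;> fin_cases j <;>
    simp [jacobian, rapidityEqs, rapidityMatrix, MvPolynomial.pderiv_X, Derivation.leibniz_pow]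

theorem natCast_mul_pow_eq_zero_iff (hN : 2 ≤ N) {z : ℂ} : (N : ℂ) * z ^ (N - 1) = 0 ↔ z = 0 := by
  rw [mul_eq_zero, pow_eq_zero_iff (by lia), Nat.cast_eq_zero, or_iff_right (by lia)]

theorem rep_eq_zero_or_of_mem_projSing (hN : 2 ≤ N) {p : ℙ ℂ (Fin 4 → ℂ)}
    (hp : p ∈ projSing 2 (rapidityEqs N κ)) {r r' i j : Fin 4} (hi : rapidityMatrix κ r i ≠ 0)
    (hj : rapidityMatrix κ r' j ≠ 0) (hi' : rapidityMatrix κ r' i = 0) :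
    p.rep i = 0 ∨ p.rep j = 0 := by
  have minor_eq_zero := minor_eq_zero_of_rank_lt_two hp.2 r r' i j
  simpa only [jacobian_rapidityEqs, hi', zero_mul, mul_zero, mul_eq_zero (b := _ * (_ * _)),
    mul_eq_zero (a := rapidityMatrix κ _ _), hi, hj, false_or, natCast_mul_pow_eq_zero_iff hN]
    using minor_eq_zero

theorem pair_eq_zero_of_mem_projSing (hN : 2 ≤ N) {p : ℙ ℂ (Fin 4 → ℂ)}
    (hp : p ∈ projSing 2 (rapidityEqs N κ)) (r r' : Fin 4) {i i' j j' : Fin 4}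
    (hi : rapidityMatrix κ r i ≠ 0 ∧ rapidityMatrix κ r' i = 0)
    (hi' : rapidityMatrix κ r i' ≠ 0 ∧ rapidityMatrix κ r' i' = 0)
    (hj : rapidityMatrix κ r' j ≠ 0) (hj' : rapidityMatrix κ r' j' ≠ 0) :
    (p.rep i = 0 ∧ p.rep i' = 0) ∨ (p.rep j = 0 ∧ p.rep j' = 0) := by
  have hij := rep_eq_zero_or_of_mem_projSing hN hp hi.1 hj hi.2
  have hij' := rep_eq_zero_or_of_mem_projSing hN hp hi.1 hj' hi.2
  have hi'j := rep_eq_zero_or_of_mem_projSing hN hp hi'.1 hj hi'.2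
  have hi'j' := rep_eq_zero_or_of_mem_projSing hN hp hi'.1 hj' hi'.2
  tauto

theorem hasVanishingPair_of_zeroOrInfty (hN : 2 ≤ N) (hκ : κ.ZeroOrInfty) {p : Fermat N}
    (hp : p ∈ fibreSing N κ) : HasVanishingPair IsScalarPair p := by
  have hne := κ.ne_zero
  have hconic := κ.conic
  simp only [ne_eq, Prod.mk_eq_zero] at hne
  rcases hκ with h | h
  · have hk : κ.k ≠ 0 := by grind
    have hk₀ : κ.k₀ ≠ 0 := by grind
    rcases pair_eq_zero_of_mem_projSing hN hp 0 1 (i := 0) (i' := 3) (j := 1) (j' := 2)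
      (by simpa [rapidityMatrix]) (by simp [rapidityMatrix, *]) (by simpa [rapidityMatrix])
      (by simpa [rapidityMatrix]) with hpair | hpair
    · exact ⟨0, 3, by simp [IsScalarPair], hpair⟩
    · exact ⟨1, 2, by simp [IsScalarPair], hpair⟩
  · have hk : κ.k ≠ 0 := by grind
    have hk' : κ.k' ≠ 0 := by grind
    rcases pair_eq_zero_of_mem_projSing hN hp 0 1 (i := 0) (i' := 2) (j := 1) (j' := 3)
      (by simpa [rapidityMatrix]) (by simp [rapidityMatrix, *]) (by simpa [rapidityMatrix])
      (by simpa [rapidityMatrix]) with hpair | hpair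
    · exact ⟨0, 2, by simp [IsScalarPair], hpair⟩
    · exact ⟨1, 3, by simp [IsScalarPair], hpair⟩

theorem hasVanishingPair_of_plusMinusOne (hN : 2 ≤ N) (hκ : κ.PlusMinusOne) {p : Fermat N}
    (hp : p ∈ fibreSing N κ) : HasVanishingPair IsTypeAPair p := by
  have hne := κ.ne_zero
  have hconic := κ.conic
  have hsq : κ.k' ^ 2 = κ.k₀ ^ 2 := sq_eq_sq_iff_eq_or_eq_neg.2 hκ
  simp only [ne_eq, Prod.mk_eq_zero] at hne
  have hk : κ.k = 0 := by grind
  have hk₀ : κ.k₀ ≠ 0 := by grind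
  have hk' : κ.k' ≠ 0 := by grind
  rcases pair_eq_zero_of_mem_projSing hN hp 0 2 (i := 2) (i' := 3) (j := 0) (j' := 1)
    (by simpa [rapidityMatrix]) (by simp [rapidityMatrix, *]) (by simpa [rapidityMatrix])
    (by simpa [rapidityMatrix]) with hpair | hpair
  · exact ⟨2, 3, by simp [IsTypeAPair], hpair⟩
  · exact ⟨0, 1, by simp [IsTypeAPair], hpair⟩

theorem mem_fibreSing_of_pair (hN : 2 ≤ N) {p : Fermat N} {i j : Fin 4} (hi : p.1.rep i = 0)
    (hj : p.1.rep j = 0) (l m : Fin 4) (hlm : l ≠ m) (cover : ∀ r, r = i ∨ r = j ∨ r = l ∨ r = m)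
    (hm : p.1.rep m ≠ 0)
    (hrel : ∀ r, rapidityMatrix κ r l * p.1.rep l ^ N + rapidityMatrix κ r m * p.1.rep m ^ N = 0) :
    p ∈ fibreSing N κ := by
  have hmN : p.1.rep m ^ N ≠ 0 := pow_ne_zero N hm
  have h0 (r : Fin 4) (hrl : r ≠ l) (hrm : r ≠ m) : p.1.rep r = 0 := by
    rcases cover r with rfl | rfl | rfl | rfl <;> first | assumption | contradiction
  refine ⟨fun r => ?_, ?_⟩
  · rw [eval_rapidityEqs, Fintype.sum_eq_add l m hlm, hrel]
    rintro j ⟨hjl, hjm⟩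
    rw [h0 j hjl hjm, zero_pow (by lia), mul_zero]
  · let c : Fin 4 → ℂ := fun j => if j = m then -(p.1.rep l ^ N / p.1.rep m ^ N) else 1
    have column_eq (r : Fin 4) : rapidityMatrix κ r m = rapidityMatrix κ r l * c m := by
      simp only [c, if_true]
      field_simp
      linear_combination hrel r
    have jacobian_eq : jacobian (rapidityEqs N κ) p.1.rep = Matrix.vecMulVec
        (fun r => rapidityMatrix κ r l) (fun j => c j * (N * p.1.rep j ^ (N - 1))) := by
      ext r j
      rw [jacobian_rapidityEqs, Matrix.vecMulVec_apply]
      rcases eq_or_ne j m with rfl | hjm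
      · rw [column_eq, mul_assoc]
      rcases eq_or_ne j l with rfl | hjl
      · simp only [c, if_neg hjm, one_mul]
      · simp only [(natCast_mul_pow_eq_zero_iff hN).2 (h0 j hjl hjm), mul_zero]
    rw [jacobian_eq]
    exact (Matrix.rank_vecMulVec_le _ _).trans_lt one_lt_two

theorem exists_zeroOrInfty_of_hasVanishingPair (hN : 2 ≤ N) {p : Fermat N}
    (hp : HasVanishingPair IsScalarPair p) : ∃ κ : Param, κ.ZeroOrInfty ∧ p ∈ fibreSing N κ := by
  obtain ⟨i, j, hij, hi, hj⟩ := hp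
  have : NeZero N := ⟨by lia⟩
  have rep_ne_zero (l : Fin 4) := rep_ne_zero_of_pair (l := l) p hij.ne hi hj
  have hsq := rep_sq_add_rep_sq p
  -- Each rapidity equation has at most two nonzero terms left; `[k' : k : k₀]` solves one of them.
  rcases hij with ⟨rfl, rfl⟩ | ⟨rfl, rfl⟩ | ⟨rfl, rfl⟩ | ⟨rfl, rfl⟩ <;>
    simp only [hi, hj, zero_pow (NeZero.ne N), zero_pow two_ne_zero, zero_add, add_zero] at hsq
  · have h3 := rep_ne_zero 3 (by decide) (by decide)
    refine ⟨⟨p.1.rep 1 ^ N, -p.1.rep 3 ^ N, 0, by simp [h3], by linear_combination -hsq⟩,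
      Or.inr rfl, mem_fibreSing_of_pair hN hi hj 1 3 (by decide) (by decide) h3 fun r => ?_⟩
    fin_cases r <;> simp [rapidityMatrix] <;> grind
  · have h2 := rep_ne_zero 2 (by decide) (by decide)
    refine ⟨⟨0, p.1.rep 2 ^ N, p.1.rep 1 ^ N, by simp [h2], by linear_combination hsq⟩, Or.inl rfl,
      mem_fibreSing_of_pair hN hi hj 1 2 (by decide) (by decide) h2 fun r => ?_⟩
    fin_cases r <;> simp [rapidityMatrix] <;> grind
  · have h3 := rep_ne_zero 3 (by decide) (by decide)
    refine ⟨⟨0, p.1.rep 3 ^ N, p.1.rep 0 ^ N, by simp [h3], by linear_combination -hsq⟩, Or.inl rfl,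
      mem_fibreSing_of_pair hN hi hj 0 3 (by decide) (by decide) h3 fun r => ?_⟩
    fin_cases r <;> simp [rapidityMatrix] <;> grind
  · have h2 := rep_ne_zero 2 (by decide) (by decide)
    refine ⟨⟨p.1.rep 0 ^ N, -p.1.rep 2 ^ N, 0, by simp [h2], by linear_combination hsq⟩, Or.inr rfl,
      mem_fibreSing_of_pair hN hi hj 0 2 (by decide) (by decide) h2 fun r => ?_⟩
    fin_cases r <;> simp [rapidityMatrix] <;> grind

theorem exists_plusMinusOne_of_hasVanishingPair (hN : 2 ≤ N) {p : Fermat N}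
    (hp : HasVanishingPair IsTypeAPair p) : ∃ κ : Param, κ.PlusMinusOne ∧ p ∈ fibreSing N κ := by
  obtain ⟨i, j, hij, hi, hj⟩ := hp
  have : NeZero N := ⟨by lia⟩
  have rep_ne_zero (l : Fin 4) := rep_ne_zero_of_pair (l := l) p hij.ne hi hj
  have hsq := rep_sq_add_rep_sq p
  rcases hij with ⟨rfl, rfl⟩ | ⟨rfl, rfl⟩ <;>
    simp only [hi, hj, zero_pow (NeZero.ne N), zero_pow two_ne_zero, zero_add] at hsq
  · have h3 := rep_ne_zero 3 (by decide) (by decide)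
    refine ⟨⟨p.1.rep 3 ^ N, 0, p.1.rep 2 ^ N, by simp [h3], by linear_combination -hsq⟩,
      sq_eq_sq_iff_eq_or_eq_neg.1 hsq.symm,
      mem_fibreSing_of_pair hN hi hj 2 3 (by decide) (by decide) h3 fun r => ?_⟩
    fin_cases r <;> simp [rapidityMatrix] <;> grind
  · have h1 := rep_ne_zero 1 (by decide) (by decide)
    refine ⟨⟨-p.1.rep 0 ^ N, 0, p.1.rep 1 ^ N, by simp [h1], by linear_combination hsq⟩,
      sq_eq_sq_iff_eq_or_eq_neg.1 (by simpa using hsq),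
      mem_fibreSing_of_pair hN hi hj 0 1 (by decide) (by decide) h1 fun r => ?_⟩
    fin_cases r <;> simp [rapidityMatrix] <;> grind

end Fibres

/-! ### The isotropy groups -/

section Isotropy

theorem norm_diag_apply {n : ℕ} {t : Fin n → ℂˣ} (ht : ∀ i, ‖(t i : ℂ)‖ = 1) (x : Fin n → ℂ) :
    ‖diag t x‖ = ‖x‖ := by
  have nnnorm_eq_one (i : Fin n) : ‖(t i : ℂ)‖₊ = 1 := NNReal.eq (ht i)
  simp only [Pi.norm_def, diag_apply, nnnorm_mul, nnnorm_eq_one, one_mul]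

theorem diag_pair_pow (u v : ℂˣ) (k : ℕ) : diag ![u, v] ^ k = diag ![u ^ k, v ^ k] := by
  induction k with
  | zero =>
    ext x i
    fin_cases i <;> simp
  | succ k ih =>
    rw [pow_succ, ih, ← diag_mul]
    ext x i
    fin_cases i <;> simp [pow_succ]

variable {N : ℕ}

theorem apply_eq_of_mem_torus {t : Fin 4 → ℂˣ} (ht : t ∈ torus N) {i : Fin 4} {τ : ℂˣ}
    (hτ : ∀ r, r ≠ i → t r = τ) : t i = τ := by
  have hrel := ht.2
  fin_cases i <;> simp_all

variable (s : Equiv.Perm (Fin 4))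

/-- The action of diagonal matrices on the affine coordinates selected by `s`. -/
def affineAction : (Fin 4 → ℂˣ) →* GLin 2 where
  toFun t := diag ![t (s 0) / t (s 2), t (s 1) / t (s 2)]
  map_one' := by
    ext x i
    fin_cases i <;> simp
  map_mul' t t' := by
    rw [← diag_mul]
    ext x i
    fin_cases i <;> simp [mul_div_mul_comm]

theorem affineAction_apply (t : Fin 4 → ℂˣ) :
    affineAction s t = diag ![t (s 0) / t (s 2), t (s 1) / t (s 2)] := rfl

theorem diag_chartVec {t : Fin 4 → ℂˣ} (h : t (s 3) = t (s 2)) (x : Fin 2 → ℂ) (ζ : ℂ) :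
    diag t (chartVec s x ζ) = t (s 2) • chartVec s (affineAction s t x) ζ := by
  ext r
  obtain ⟨k, rfl⟩ := s.surjective r
  rw [diag_apply, Pi.smul_apply, chartVec_apply, chartVec_apply, Units.smul_def, smul_eq_mul]
  fin_cases k <;> simp [affineAction_apply, h] <;> field_simp

theorem lastPow_affineAction {t : Fin 4 → ℂˣ} (ht : t ∈ torus N) (x : Fin 2 → ℂ) :
    lastPow N s (affineAction s t x) = lastPow N s x := by
  simp [lastPow, affineAction_apply, mul_pow, div_pow, torus_pow_two_mul ht]

theorem norm_affineAction_apply [NeZero N] {t : Fin 4 → ℂˣ} (ht : t ∈ torus N) (x : Fin 2 → ℂ) :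
    ‖affineAction s t x‖ = ‖x‖ := by
  have norm_eq_one (i : Fin 4) : ‖(t i : ℂ)‖ = 1 :=
    Complex.norm_eq_one_of_pow_eq_one (torus_pow_two_mul ht i) (by simp [NeZero.ne])
  exact norm_diag_apply (fun i => by fin_cases i <;> simp [norm_eq_one]) x

theorem linearizes_fermatParam {P : OpenPartialHomeomorph ℂ ℂ} (hP : IsRootBranch (2 * N) P)
    (p : Fermat N) {h : H N} {t : torus N} (ht : ∀ q : Fermat N, h • q = torusAut N t q)
    (h32 : t.1 (s 3) = t.1 (s 2)) : Linearizes (fermatParam s hP p) h (affineAction s t.1) := by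
  intro x hx
  have hx' : lastPow N s (affineAction s t.1 x) ∈ P.target := by rwa [lastPow_affineAction s t.2]
  refine ⟨hx', Subtype.ext ?_⟩
  rw [ht, torusAut_apply]
  change (branchPoint s hP p _).1 = diag t.1 • (branchPoint s hP p x).1
  rw [branchPoint_coe s hP p hx', branchPoint_coe s hP p hx, Projectivization.smul_mk]
  refine ((Projectivization.mk_eq_mk_iff _ _ _ _ _).2 ⟨t.1 (s 2), ?_⟩).symm
  rw [lastPow_affineAction s t.2]
  exact (diag_chartVec s h32 x _).symm

/-- The action on the affine coordinates of the diagonal matrices in the torus that fix the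
point `p` of the Fermat surface. -/
def isotropyGroup (p : Fermat N) : Subgroup (GLin 2) :=
  ((MulAction.stabilizer (Equiv.Perm (Fermat N)) p).comap (torusAut N)).map
    ((affineAction s).comp (torus N).subtype)

variable {s}

theorem mem_isotropyGroup {p : Fermat N} {k : GLin 2} :
    k ∈ isotropyGroup s p ↔ ∃ t : torus N, torusAut N t p = p ∧ affineAction s t.1 = k := Iff.rfl

theorem torus_apply_eq_of_torusAut_apply_eq_self {p : Fermat N}
    (hp : ∀ k, k ≠ 0 → p.1.rep (s k) ≠ 0) {t : torus N} (hfix : torusAut N t p = p) (i : Fin 4) :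
    t.1 i = t.1 (s 2) := by
  have apply_eq (r : Fin 4) (hr : r ≠ s 0) : t.1 r = t.1 (s 2) := by
    obtain ⟨k, rfl⟩ := s.surjective r
    exact torusAut_apply_eq_self_iff.1 hfix _ _ (hp k (mt (congrArg s) hr)) (hp 2 (by decide))
  rcases eq_or_ne i (s 0) with rfl | hi
  · exact apply_eq_of_mem_torus t.2 apply_eq
  · exact apply_eq i hi

theorem isotropyGroup_eq_bot {p : Fermat N} (hp : ∀ k, k ≠ 0 → p.1.rep (s k) ≠ 0) :
    isotropyGroup s p = ⊥ := by
  rw [eq_bot_iff]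
  rintro _ ⟨t, hfix, rfl⟩
  have apply_eq := torus_apply_eq_of_torusAut_apply_eq_self hp hfix
  change affineAction s t.1 = 1
  ext x i
  fin_cases i <;> simp [affineAction_apply, apply_eq (s 0), apply_eq (s 1)]

variable [NeZero N]

instance finite_isotropyGroup (p : Fermat N) : Finite (isotropyGroup s p) :=
  ((Set.toFinite _).image ((affineAction s).comp (torus N).subtype)).to_subtype

instance locallyCompactSpace_fermat : LocallyCompactSpace (Fermat N) := by
  refine locallyCompactSpace_of_localParams (n := 2) fun p => ?_
  obtain ⟨s, h2, h3⟩ := exists_perm_rep_ne_zero p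
  obtain ⟨P, hP, hp⟩ := exists_isRootBranch_mem_target s h2 h3
  exact ⟨fermatParam s hP p, hp⟩

theorem exists_liftedChart_isotropyGroup {p : Fermat N} (h2 : p.1.rep (s 2) ≠ 0)
    (h3 : p.1.rep (s 3) ≠ 0) : ∃ c : OrbifoldChart 2 (WH N), IsLiftedChart c ∧
      c.group = isotropyGroup s p ∧ affineCoords s p.1 ∈ c.dom ∧
      c.toFun (affineCoords s p.1) = toWH N p := by
  obtain ⟨P, hP, hp⟩ := exists_isRootBranch_mem_target s h2 h3
  have apply_coords : fermatParam s hP p (affineCoords s p.1) = p :=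
    (fermatParam s hP p).right_inv hp
  have mem_source : affineCoords s p.1 ∈ (fermatParam s hP p).source :=
    (fermatParam s hP p).map_target hp
  have key := exists_liftedChart actsHolomorphically_H (isLocalParam_fermatParam s hP p) mem_source
    (K := isotropyGroup s p) inferInstance ?_ ?_ ?_
  · rwa [apply_coords] at key
  · rintro _ ⟨t, -, rfl⟩ x
    exact norm_affineAction_apply s t.2 x
  · intro h hh
    obtain ⟨t, ht⟩ := exists_torusAut_eq_smul h
    rw [apply_coords, ht] at hh
    exact ⟨_, mem_isotropyGroup.2 ⟨t, hh, rfl⟩, linearizes_fermatParam s hP p ht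
      (torusAut_apply_eq_self_iff.1 hh _ _ h3 h2)⟩
  · rintro _ ⟨t, hfix, rfl⟩
    obtain ⟨h, ht⟩ := exists_smul_eq_torusAut t
    refine ⟨h, ?_, linearizes_fermatParam s hP p ht (torusAut_apply_eq_self_iff.1 hfix _ _ h3 h2)⟩
    rw [apply_coords, ht]
    exact hfix

theorem apply_eq_of_ne {α : Type*} {t : Fin 4 → α} (h : t (s 3) = t (s 2)) (r : Fin 4)
    (h0 : r ≠ s 0) (h1 : r ≠ s 1) : t r = t (s 2) := by
  obtain ⟨k, rfl⟩ := s.surjective r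
  fin_cases k <;> simp_all

theorem isotropyGroup_eq_zpowers (φ : ℂˣ →* ℂˣ) (hφ : ∀ t : Fin 4 → ℂˣ, t (s 3) = t (s 2) →
      (t 0 * t 1 = t 2 * t 3 ↔ t (s 1) / t (s 2) = φ (t (s 0) / t (s 2)))) {p : Fermat N}
    (h0 : p.1.rep (s 0) = 0) (h1 : p.1.rep (s 1) = 0) (h2 : p.1.rep (s 2) ≠ 0)
    (h3 : p.1.rep (s 3) ≠ 0) :
    isotropyGroup s p = Subgroup.zpowers (diag ![omega N, φ (omega N)]) := by
  apply le_antisymm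
  · rintro _ ⟨t, hfix, rfl⟩
    have h32 := torusAut_apply_eq_self_iff.1 hfix _ _ h3 h2
    obtain ⟨k, hk⟩ := exists_omega_pow_eq (N := N) (u := t.1 (s 0) / t.1 (s 2)) (by
      rw [div_pow, t.2.1, t.2.1, div_one])
    refine ⟨k, ?_⟩
    change diag ![omega N, φ (omega N)] ^ (k : ℤ) = affineAction s t.1
    rw [zpow_natCast, diag_pair_pow, affineAction_apply, (hφ t.1 h32).1 t.2.2, ← hk, map_pow]
  · rw [Subgroup.zpowers_le]
    let t : Fin 4 → ℂˣ := fun r => ![omega N, φ (omega N), 1, 1] (s.symm r)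
    have apply_eq (k : Fin 4) : t (s k) = ![omega N, φ (omega N), 1, 1] k := by simp [t]
    have ht : t ∈ torus N := by
      refine ⟨fun r => ?_, (hφ t (by simp [apply_eq])).2 (by simp [apply_eq])⟩
      obtain ⟨k, rfl⟩ := s.surjective r
      rw [apply_eq]
      fin_cases k <;> simp [omega_pow_eq_one, ← map_pow]
    refine mem_isotropyGroup.2 ⟨⟨t, ht⟩, torusAut_apply_eq_self_iff.2 fun i j hi hj => ?_, ?_⟩
    · obtain ⟨k, rfl⟩ := s.surjective i
      obtain ⟨l, rfl⟩ := s.surjective j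
      fin_cases k <;> fin_cases l <;> simp_all
    · simp [affineAction_apply, apply_eq]

theorem isotropyGroup_eq_scalarGroup {p : Fermat N} (hs : IsScalarPair (s 0) (s 1))
    (h0 : p.1.rep (s 0) = 0) (h1 : p.1.rep (s 1) = 0) (h2 : p.1.rep (s 2) ≠ 0)
    (h3 : p.1.rep (s 3) ≠ 0) : isotropyGroup s p = scalarGroup N := by
  refine isotropyGroup_eq_zpowers (MonoidHom.id ℂˣ) (fun t h32 => ?_) h0 h1 h2 h3
  have apply_eq := apply_eq_of_ne h32
  rcases hs with ⟨hi, hj⟩ | ⟨hi, hj⟩ | ⟨hi, hj⟩ | ⟨hi, hj⟩ <;> rw [hi, hj] at apply_eq ⊢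
  · rw [apply_eq 1 (by decide) (by decide), apply_eq 3 (by decide) (by decide)]
    simp [eq_comm]
  · rw [apply_eq 1 (by decide) (by decide), apply_eq 2 (by decide) (by decide)]
    simp [mul_comm (t (s 2)), eq_comm]
  · rw [apply_eq 0 (by decide) (by decide), apply_eq 3 (by decide) (by decide)]
    simp [mul_comm (t (s 2)), eq_comm]
  · rw [apply_eq 0 (by decide) (by decide), apply_eq 2 (by decide) (by decide)]
    simp [mul_comm (t (s 2)), eq_comm]

theorem isotropyGroup_eq_typeAGroup {p : Fermat N} (hs : IsTypeAPair (s 0) (s 1))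
    (h0 : p.1.rep (s 0) = 0) (h1 : p.1.rep (s 1) = 0) (h2 : p.1.rep (s 2) ≠ 0)
    (h3 : p.1.rep (s 3) ≠ 0) : isotropyGroup s p = typeAGroup N := by
  refine isotropyGroup_eq_zpowers invMonoidHom (fun t h32 => ?_) h0 h1 h2 h3
  have apply_eq := apply_eq_of_ne h32
  rcases hs with ⟨hi, hj⟩ | ⟨hi, hj⟩ <;> rw [hi, hj] at apply_eq ⊢
  · rw [apply_eq 2 (by decide) (by decide), apply_eq 3 (by decide) (by decide)]
    simp [div_eq_div_iff_mul_eq_mul, mul_comm]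
  · rw [apply_eq 0 (by decide) (by decide), apply_eq 1 (by decide) (by decide)]
    simp [div_eq_div_iff_mul_eq_mul, mul_comm, eq_comm]

end Isotropy

/-! ### The orbifold structure of the quotient surface -/

section LocalModels

variable {n : ℕ} {X : Type*} [TopologicalSpace X] [HolSpace X] {A : OrbifoldAtlas n X} {q : X}
  {G : Subgroup (GLin n)}

theorem OrbifoldAtlas.LocallyQuotient.germIso (h : A.LocallyQuotient q G) :
    GermIso q (Quotient.mk _ 0 : MulAction.orbitRel.Quotient G (Fin n → ℂ)) := by
  obtain ⟨c, -, rfl, h0, rfl⟩ := h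
  exact c.germIso h0

theorem OrbifoldAtlas.LocallyQuotient.isNonsingularAt_origin (h : A.LocallyQuotient q G)
    (hq : IsNonsingularAt n q) :
    IsNonsingularAt n (Quotient.mk _ 0 : MulAction.orbitRel.Quotient G (Fin n → ℂ)) := by
  obtain ⟨c, -, rfl, h0, rfl⟩ := h
  exact (c.germIso_symm h0).trans hq

theorem OrbifoldAtlas.LocallyQuotient.mem_singularLocus (h : A.LocallyQuotient q G) {g : GLin n}
    (hg : g ∈ G) (hg1 : g ≠ 1) : q ∈ A.singularLocus := by
  obtain ⟨c, hc, rfl, h0, hq⟩ := h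
  exact ⟨c, hc, 0, h0, hq, g, hg, hg1, map_zero g⟩

end LocalModels

section QuotientSurface

variable {N : ℕ}

theorem singImage_eq_image (hN : 2 ≤ N) :
    singImage N = toWH N '' {p | HasVanishingPair (· ≠ ·) p} := by
  ext q
  constructor
  · rintro ⟨κ, hκ, p, hp, rfl⟩
    exact ⟨p, hasVanishingPair_ne_iff.2 (hκ.imp (hasVanishingPair_of_zeroOrInfty hN · hp)
      (hasVanishingPair_of_plusMinusOne hN · hp)), rfl⟩
  · rintro ⟨p, hp, rfl⟩
    rcases hasVanishingPair_ne_iff.1 hp with hp | hp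
    · obtain ⟨κ, hκ, hpκ⟩ := exists_zeroOrInfty_of_hasVanishingPair hN hp
      exact ⟨κ, Or.inl hκ, p, hpκ, rfl⟩
    · obtain ⟨κ, hκ, hpκ⟩ := exists_plusMinusOne_of_hasVanishingPair hN hp
      exact ⟨κ, Or.inr hκ, p, hpκ, rfl⟩

theorem diag_omega_ne_one (hN : 2 ≤ N) (u : ℂˣ) : diag ![omega N, u] ≠ 1 := by
  intro h
  have apply_eq : (omega N : ℂ) = 1 := by
    simpa [diag_pair_apply] using congrFun (LinearEquiv.congr_fun h ![1, 0]) 0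
  exact (isPrimitiveRoot_omega (N := N) (by lia)).ne_one (by lia) apply_eq

theorem hasVanishingPair_of_torusAut_ne_one {t : torus N} {p : Fermat N}
    (hfix : torusAut N t p = p) (ht : torusAut N t ≠ 1) : HasVanishingPair (· ≠ ·) p := by
  by_contra hp
  obtain ⟨s, hs⟩ := exists_perm_of_not_hasVanishingPair hp
  have apply_eq := torus_apply_eq_of_torusAut_apply_eq_self hs hfix
  refine ht (Equiv.ext fun q => torusAut_apply_eq_self_iff.2 fun i j _ _ => ?_)
  rw [apply_eq i, apply_eq j]

variable [NeZero N]

variable (N) in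
/-- The orbifold structure of the quotient surface whose charts are lifted to the Fermat surface. -/
def surfaceAtlas : OrbifoldAtlas 2 (WH N) :=
  quotientAtlas actsHolomorphically_H fun q => by
    obtain ⟨p, rfl⟩ : ∃ p, toWH N p = q := Quotient.exists_rep q
    obtain ⟨s, h2, h3⟩ := exists_perm_rep_ne_zero p
    obtain ⟨c, hc, -, hmem, hcp⟩ := exists_liftedChart_isotropyGroup h2 h3
    exact ⟨c, hc, _, hmem, hcp⟩

theorem locallyQuotient_isotropyGroup {s : Equiv.Perm (Fin 4)} {p : Fermat N}
    (h0 : p.1.rep (s 0) = 0) (h1 : p.1.rep (s 1) = 0) (h2 : p.1.rep (s 2) ≠ 0)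
    (h3 : p.1.rep (s 3) ≠ 0) :
    (surfaceAtlas N).LocallyQuotient (toWH N p) (isotropyGroup s p) := by
  have coords_eq_zero : affineCoords s p.1 = 0 := by
    ext i
    fin_cases i <;> simp [affineCoords, coordRatio, h0, h1]
  have h := exists_liftedChart_isotropyGroup h2 h3
  rwa [coords_eq_zero] at h

theorem locallyQuotient_scalarGroup {p : Fermat N} (hp : HasVanishingPair IsScalarPair p) :
    (surfaceAtlas N).LocallyQuotient (toWH N p) (scalarGroup N) := by
  obtain ⟨s, hs, h0, h1, h2, h3⟩ := exists_perm_of_hasVanishingPair IsScalarPair.ne hp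
  rw [← isotropyGroup_eq_scalarGroup hs h0 h1 h2 h3]
  exact locallyQuotient_isotropyGroup h0 h1 h2 h3

theorem locallyQuotient_typeAGroup {p : Fermat N} (hp : HasVanishingPair IsTypeAPair p) :
    (surfaceAtlas N).LocallyQuotient (toWH N p) (typeAGroup N) := by
  obtain ⟨s, hs, h0, h1, h2, h3⟩ := exists_perm_of_hasVanishingPair IsTypeAPair.ne hp
  rw [← isotropyGroup_eq_typeAGroup hs h0 h1 h2 h3]
  exact locallyQuotient_isotropyGroup h0 h1 h2 h3

theorem isNonsingularAt_of_not_hasVanishingPair {p : Fermat N}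
    (hp : ¬ HasVanishingPair (· ≠ ·) p) : IsNonsingularAt 2 (toWH N p) := by
  obtain ⟨s, hs⟩ := exists_perm_of_not_hasVanishingPair hp
  obtain ⟨c, -, hc, hmem, hcp⟩ :=
    exists_liftedChart_isotropyGroup (hs 2 (by decide)) (hs 3 (by decide))
  rw [← hcp]
  exact c.isNonsingularAt_of_group_eq_bot (hc.trans (isotropyGroup_eq_bot hs)) hmem

theorem singularLocus_surfaceAtlas (hN : 2 ≤ N) : (surfaceAtlas N).singularLocus = singImage N := by
  rw [singImage_eq_image hN]
  ext q
  constructor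
  · rintro ⟨c, hc, x, hx, rfl, k, hk, hk1, hkx⟩
    obtain ⟨h, p, hcp, hfix, q, hq⟩ :=
      IsLiftedChart.exists_smul_eq_of_apply_eq hc hk hk1 hx hkx
    obtain ⟨t, ht⟩ := exists_torusAut_eq_smul h
    rw [ht] at hfix hq
    exact ⟨p, hasVanishingPair_of_torusAut_ne_one hfix fun h1 => hq (by rw [h1]; rfl), hcp.symm⟩
  · rintro ⟨p, hp, rfl⟩
    rcases hasVanishingPair_ne_iff.1 hp with hp | hp
    · exact (locallyQuotient_scalarGroup hp).mem_singularLocus (Subgroup.mem_zpowers _)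
        (diag_omega_ne_one hN _)
    · exact (locallyQuotient_typeAGroup hp).mem_singularLocus (Subgroup.mem_zpowers _)
        (diag_omega_ne_one hN _)

theorem setOf_not_isNonsingularAt (hN : 2 ≤ N) :
    {q : WH N | ¬ IsNonsingularAt 2 q} = singImage N := by
  rw [singImage_eq_image hN]
  apply subset_antisymm
  · intro q hq
    obtain ⟨p, rfl⟩ : ∃ p, toWH N p = q := Quotient.exists_rep q
    exact ⟨p, not_not.1 fun hp => hq (isNonsingularAt_of_not_hasVanishingPair hp), rfl⟩
  · rintro _ ⟨p, hp, rfl⟩ hsmooth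
    rcases hasVanishingPair_ne_iff.1 hp with hp | hp
    · exact not_isNonsingularAt_scalarGroup hN
        ((locallyQuotient_scalarGroup hp).isNonsingularAt_origin hsmooth)
    · exact not_isNonsingularAt_typeAGroup hN
        ((locallyQuotient_typeAGroup hp).isNonsingularAt_origin hsmooth)

end QuotientSurface

end RapidityFamily

end

theorem mainTheorem6 (N : ℕ) (hN : 2 ≤ N) :
    ∃ A : RapidityFamily.OrbifoldAtlas 2 (RapidityFamily.WH N),
      A.singularLocus = RapidityFamily.singImage N ∧
      {q : RapidityFamily.WH N | ¬ RapidityFamily.IsNonsingularAt 2 q} =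
        RapidityFamily.singImage N ∧
      (∀ κ : RapidityFamily.Param, κ.ZeroOrInfty → ∀ p ∈ RapidityFamily.fibreSing N κ,
        A.LocallyQuotient (RapidityFamily.toWH N p) (RapidityFamily.scalarGroup N) ∧
        RapidityFamily.GermIso (RapidityFamily.toWH N p)
          (RapidityFamily.planeOrigin (RapidityFamily.scalarGroup N))) ∧
      (∀ κ : RapidityFamily.Param, κ.PlusMinusOne → ∀ p ∈ RapidityFamily.fibreSing N κ,
        A.LocallyQuotient (RapidityFamily.toWH N p) (RapidityFamily.typeAGroup N) ∧
        RapidityFamily.GermIso (RapidityFamily.toWH N p)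
          (RapidityFamily.planeOrigin (RapidityFamily.typeAGroup N))) := by
  have : NeZero N := ⟨by lia⟩
  refine ⟨RapidityFamily.surfaceAtlas N, RapidityFamily.singularLocus_surfaceAtlas hN,
    RapidityFamily.setOf_not_isNonsingularAt hN, fun κ hκ p hp => ?_, fun κ hκ p hp => ?_⟩
  · have h := RapidityFamily.locallyQuotient_scalarGroup
      (RapidityFamily.hasVanishingPair_of_zeroOrInfty hN hκ hp)
    exact ⟨h, h.germIso⟩
  · have h := RapidityFamily.locallyQuotient_typeAGroup
      (RapidityFamily.hasVanishingPair_of_plusMinusOne hN hκ hp)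
    exact ⟨h, h.germIso⟩
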